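/- **Proposition 3.1.** Let $n\ge 3$, let $(\mathbb S^n,g)$ be the round unit sphere in $\mathbb R^{n+1}$, and put $2^*=\frac{2n}{n-2}$, $a_n=\frac{n(n-2)}4$, $c_n=\frac{n-2}{4}\,\mathrm{vol}(\mathbb S^n)$. Let $\Gamma$ be a finite subgroup of $O(n+1)$ and $\phi:\Gamma\to\{1,-1\}$ a homomorphism; write $\Gamma_p=\{\gamma\in\Gamma:\gamma p=p\}$ for $p\in\mathbb S^n$. Assume - $(A_0)$ there is $p_0\in\mathbb S^n$ with $\Gamma_{p_0}\subset\ker\phi$; - $(A_1)$ for every $p\in\mathbb S^n$, either $\Gamma_p=\Gamma$ or $\Gamma_p=\{1\}$; - $(A_2)$ $\phi$ is surjective. For $u\in H^1_g(\mathbb S^n)$ let $$J_n(u)=\tfrac12\|u\|^2-\tfrac1{2^*}|u|_{2^*}^{2^*},\qquad \|u\|^2=\int_{\mathbb S^n}\bigl(|\nabla_g u|_g^2+a_nu^2\bigr)\,dV_g,\qquad |u|_{2^*}^{2^*}=\int_{\mathbb S^n}a_n|u|^{2^*}\,dV_g ,$$ and let $c_n^\phi$ be the infimum of $J_n$ over the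 set of all $u\in H^1_g(\mathbb S^n)$ with $u\ne0$, $\|u\|^2=|u|_{2^*}^{2^*}$ and $u(\gamma p)=\phi(\gamma)u(p)$ for all $\gamma\in\Gamma$ and (almost) all $p\in\mathbb S^n$. Let $|\Gamma|=2m$, fix $\hat\gamma\in\Gamma$ with $\phi(\hat\gamma)=-1$, and write $\Gamma=\{g_1,\dots,g_m,\hat\gamma g_1,\dots,\hat\gamma g_m\}$ with $\phi(g_i)=1$ for all $i$. For $p\in\mathbb S^n$ not fixed by $\Gamma$ put $p_i=g_ip$, $q_i=\hat\gamma p_i$ and $$\mu_p=\sum_{1\le i\ne j\le m}\bigl(1-\cos d_g(p_i,p_j)\bigr)^{\frac{2-n}2},\qquad \widehat\mu_p=\sum_{1\le i,j\le m}\bigl(1-\cos d_g(p_i,q_j)\bigr)^{\frac{2-n}2},$$ where $d_g(p,p')=\arccos\langle p,p'\rangle$ is the geodesic distance on $\mathbb S^n$. If $\mu_p-\widehat\mu_p>0$ for some such $p$, then $c_n^\phi<2m\,c_n$. -/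

import Mathlib

open MeasureTheory Filter Topology
open scoped Manifold ContDiff

noncomputable section

namespace YamabeSphere

/-- The Euclidean space `ℝⁿ⁺¹`. -/
abbrev Amb (n : ℕ) : Type := EuclideanSpace ℝ (Fin (n + 1))

/-- The unit sphere `𝕊ⁿ ⊂ ℝⁿ⁺¹`, with Mathlib's smooth structure. -/
abbrev Sph (n : ℕ) : Type := Metric.sphere (0 : Amb n) 1

/-- The orthogonal group `O(n+1)`: the group of linear isometries of `ℝⁿ⁺¹`. -/
abbrev OrthGroup (n : ℕ) : Type := Amb n ≃ₗᵢ[ℝ] Amb n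

/-- The action of `O(n+1)` on `𝕊ⁿ`. -/
def act {n : ℕ} (γ : OrthGroup n) (p : Sph n) : Sph n :=
  ⟨γ (p : Amb n), by simp⟩

/-- The geodesic distance on the round sphere. -/
def geoDist {n : ℕ} (p q : Sph n) : ℝ :=
  Real.arccos (inner ℝ (p : Amb n) (q : Amb n))

/-- The Riemannian volume measure `dV_g` of the round sphere, that is, its surface measure. -/
def vol (n : ℕ) : Measure (Sph n) :=
  (volume : Measure (Amb n)).toSphere

/-- `2* = 2n / (n - 2)`. -/
def critExp (n : ℕ) : ℝ := 2 * (n : ℝ) / ((n : ℝ) - 2)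

/-- `a_n = n (n - 2) / 4`. -/
def coeffA (n : ℕ) : ℝ := (n : ℝ) * ((n : ℝ) - 2) / 4

/-- `c_n = ((n - 2) / 4) vol(𝕊ⁿ)`. -/
def cConst (n : ℕ) : ℝ := ((n : ℝ) - 2) / 4 * (vol n).real Set.univ

/-- `G` is the Riemannian gradient of `f : 𝕊ⁿ → ℝ` for the round metric `g`. Tangent vectors
`v` at `x` are identified with their images `dι(v)` in `ℝⁿ⁺¹` under the differential of the
inclusion `ι`, and `g` is the restriction of the Euclidean inner product. So `G x` is the vector
orthogonal to `x` with `⟨G x, dι(v)⟩ = df(v)` for all tangent vectors `v` at `x`. -/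
def IsGradient {n : ℕ} (f : Sph n → ℝ) (G : Sph n → Amb n) : Prop :=
  ∀ x : Sph n, inner ℝ (x : Amb n) (G x) = 0 ∧
    ∀ v : TangentSpace (𝓡 n) x,
      inner ℝ (G x) (mvfderiv (𝓡 n) (fun y : Sph n => (y : Amb n)) x v) = mvfderiv (𝓡 n) f x v

/-- `u` lies in the Sobolev space `H¹_g(𝕊ⁿ)` and `G` is its (Sobolev) gradient. Here `H¹_g(𝕊ⁿ)` is
the completion of `C^∞(𝕊ⁿ)` in the `H¹`-norm, realised as the closure in `L² × L²` of the set of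
the pairs `(f, ∇f)` with `f` smooth. The class of `G` in `L²` is determined by that of `u`. -/
def MemH1 {n : ℕ} (u : Sph n → ℝ) (G : Sph n → Amb n) : Prop :=
  MemLp u 2 (vol n) ∧ MemLp G 2 (vol n) ∧
    ∃ (f : ℕ → Sph n → ℝ) (F : ℕ → Sph n → Amb n),
      (∀ k, ContMDiff (𝓡 n) 𝓘(ℝ, ℝ) ∞ (f k)) ∧ (∀ k, IsGradient (f k) (F k)) ∧
      Tendsto (fun k => eLpNorm (f k - u) 2 (vol n)) atTop (𝓝 0) ∧
      Tendsto (fun k => eLpNorm (F k - G) 2 (vol n)) atTop (𝓝 0)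

/-- `‖u‖² = ∫ (|∇u|² + a_n u²) dV_g`, for `u` with gradient `G`. -/
def energyNormSq {n : ℕ} (u : Sph n → ℝ) (G : Sph n → Amb n) : ℝ :=
  ∫ x, (‖G x‖ ^ 2 + coeffA n * u x ^ 2) ∂(vol n)

/-- `|u|_{2*}^{2*} = ∫ a_n |u|^{2*} dV_g`. -/
def critNormPow {n : ℕ} (u : Sph n → ℝ) : ℝ :=
  ∫ x, coeffA n * |u x| ^ critExp n ∂(vol n)

/-- The Yamabe functional `J_n(u) = ‖u‖² / 2 - |u|_{2*}^{2*} / 2*`, for `u` with gradient `G`. -/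
def functionalJ {n : ℕ} (u : Sph n → ℝ) (G : Sph n → Amb n) : ℝ :=
  1 / 2 * energyNormSq u G - 1 / critExp n * critNormPow u

/-- `u` is `φ`-equivariant (as a class of functions modulo null sets). -/
def IsEquivariant {n : ℕ} {Γ : Subgroup (OrthGroup n)} (φ : Γ →* ℤˣ) (u : Sph n → ℝ) : Prop :=
  ∀ γ : Γ, ∀ᵐ p ∂(vol n), u (act (γ : OrthGroup n) p) = (((φ γ : ℤˣ) : ℤ) : ℝ) * u p

/-- The Nehari manifold `N^φ(𝕊ⁿ)`. Its elements `u` are recorded together with their gradient. -/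
def nehari {n : ℕ} {Γ : Subgroup (OrthGroup n)} (φ : Γ →* ℤˣ) :
    Set ((Sph n → ℝ) × (Sph n → Amb n)) :=
  {w | MemH1 w.1 w.2 ∧ IsEquivariant φ w.1 ∧ ¬ (w.1 =ᵐ[vol n] 0) ∧
    energyNormSq w.1 w.2 = critNormPow w.1}

/-- `c^φ_n = inf { J_n(u) : u ∈ N^φ(𝕊ⁿ) }`, the infimum being taken in the extended reals (so that
an empty set would give `+∞`). -/
def cEquiv {n : ℕ} {Γ : Subgroup (OrthGroup n)} (φ : Γ →* ℤˣ) : EReal :=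
  ⨅ w ∈ nehari φ, ((functionalJ w.1 w.2 : ℝ) : EReal)

/-- `(A_0)`: some isotropy group `Γ_{p₀}` is contained in `ker φ`. -/
def CondA0 {n : ℕ} {Γ : Subgroup (OrthGroup n)} (φ : Γ →* ℤˣ) : Prop :=
  ∃ p₀ : Sph n, ∀ γ : Γ, act (γ : OrthGroup n) p₀ = p₀ → φ γ = 1

/-- `(A_1)`: every isotropy group `Γ_p` is `Γ` or trivial. -/
def CondA1 {n : ℕ} (Γ : Subgroup (OrthGroup n)) : Prop :=
  ∀ p : Sph n, (∀ γ ∈ Γ, act γ p = p) ∨ (∀ γ ∈ Γ, act γ p = p → γ = 1)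

/-- `(A_2)`: `φ` is surjective. -/
def CondA2 {n : ℕ} {Γ : Subgroup (OrthGroup n)} (φ : Γ →* ℤˣ) : Prop :=
  Function.Surjective φ

/-- `μ_p = ∑_{i ≠ j} (1 - cos d_g(p_i, p_j))^{(2-n)/2}`, where `p_i = g_i p`.
If `p` is fixed by all the `g_i`, the real power `0 ^ ((2-n)/2)` is `0` by convention, and so is the
sum. -/
def muSame {n m : ℕ} (g : Fin m → OrthGroup n) (p : Sph n) : ℝ :=
  ∑ i, ∑ j, if i ≠ j then
    (1 - Real.cos (geoDist (act (g i) p) (act (g j) p))) ^ ((2 - (n : ℝ)) / 2) else 0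

/-- `μ̂_p = ∑_{i, j} (1 - cos d_g(p_i, q_j))^{(2-n)/2}`, where `p_i = g_i p`, `q_j = γ̂ p_j`.
Every term is nonnegative. -/
def muOpp {n m : ℕ} (g : Fin m → OrthGroup n) (γhat : OrthGroup n) (p : Sph n) : ℝ :=
  ∑ i, ∑ j, (1 - Real.cos (geoDist (act (g i) p) (act γhat (act (g j) p)))) ^ ((2 - (n : ℝ)) / 2)

end YamabeSphere

end

open scoped RealInnerProductSpace Pointwise

namespace YamabeSphere

variable {n : ℕ}

/-! Put `s = (n - 2) / 2` and `q = (s + 2) / s = 2* - 1`. The bubbles `U_p = (1 - r²)^(s/2) (1 -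
r⟨p, x⟩)^(-s)` solve `-ΔU + a_n U = a_n U^q`, all have `∫ U^(q+1) = vol(𝕊ⁿ) =: V`, and concentrate
at `p` as `r → 1`. The test function is the signed sum `u = ∑ φ(k) U_{kp}` over the orbit of `p`,
which is equivariant. By (A₁) and the positivity of `μ_p - μ̂_p` the orbit is free, so it has `N =
2m` distinct points.

The equation gives `‖u‖² = a_n E` with `E = ∫ u w` and `w = ∑ φ(k) U_{kp}^q` (`integral_green`,
`energyNormSq_axialSum`). Let `δ = (1 - r²)^(s/2)` and `c = ∫ (1 - r⟨p, x⟩)^(-s)`. Since `U_p^q`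
acts like a point mass `δ c` at `p`, the cross terms of `E` are `δ² c (K + o(1))` with `K = 2(μ_p -
μ̂_p)` (`eventually_interaction`, `sum_signed_interaction`). Hence `E ≥ NV + (K/2) δ² c` for `r`
near 1.

A lower bound for `B = ∫ |u|^(q+1)` is also needed. Instead of expanding a sign-changing function,
Hölder's inequality `E ≤ B^(1/(q+1)) W^(q/(q+1))` is used with `W = ∫ |w|^((q+1)/q)`. Only an upper
bound for `W` is then required. At each point all bubbles but the largest are `O(δ)`, and their
`q`-th powers are even smaller, so `W ≤ NV + o(δ² c)` (`rpow_sum_rpow_le`, `integral_dual_norm_le`).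
The gain in `E` thus beats the loss in `W`, which gives `E (E/B)^s < NV`. Scaling `u` into the
Nehari manifold (`cEquiv_le_of_scaling`) turns this into the asserted bound. -/

/-! ### Surface measure and orthogonal invariance -/

instance : IsFiniteMeasure (vol n) := by unfold vol; infer_instance

instance : (vol n).IsOpenPosMeasure := by unfold vol; infer_instance

lemma continuous_act (γ : OrthGroup n) : Continuous (act γ) := by
  unfold act; fun_prop

lemma act_mul (γ γ' : OrthGroup n) (p : Sph n) : act (γ * γ') p = act γ (act γ' p) := rfl

lemma act_one (p : Sph n) : act (1 : OrthGroup n) p = p := rfl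

/-- The surface measure of a set is a multiple of the Lebesgue measure of the cone over it, and a
linear isometry carries cones to cones while preserving Lebesgue measure. -/
lemma measurePreserving_act (γ : OrthGroup n) :
    MeasurePreserving (act γ) (vol n) (vol n) := by
  refine ⟨(continuous_act γ).measurable, ?_⟩
  ext s hs
  rw [Measure.map_apply (continuous_act γ).measurable hs]
  unfold vol
  rw [Measure.toSphere_apply' _ hs,
    Measure.toSphere_apply' _ ((continuous_act γ).measurable hs)]
  congr 1
  have : Set.Ioo (0 : ℝ) 1 • ((↑) '' (act γ ⁻¹' s) : Set (Amb n)) =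
      γ ⁻¹' (Set.Ioo (0 : ℝ) 1 • ((↑) '' s : Set (Amb n))) := by
    ext x
    simp only [Set.mem_smul, Set.mem_image, Set.mem_preimage]
    constructor
    · rintro ⟨r, hr, _, ⟨y, hy, rfl⟩, rfl⟩
      exact ⟨r, hr, _, ⟨_, hy, rfl⟩, by simp [act]⟩
    · rintro ⟨r, hr, _, ⟨y, hy, rfl⟩, h⟩
      refine ⟨r, hr, _, ⟨act γ⁻¹ y, ?_, rfl⟩, ?_⟩
      · rwa [← act_mul, mul_inv_cancel, act_one]
      · apply γ.injective
        rw [map_smul, ← h]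
        congr 1
        exact congrArg Subtype.val (show act γ (act γ⁻¹ y) = y by
          rw [← act_mul, mul_inv_cancel, act_one])
  rw [this]
  exact γ.measurePreserving.measure_preimage_equiv (f := γ.toMeasurableEquiv) _

lemma integral_comp_act (γ : OrthGroup n) (f : Sph n → ℝ) :
    ∫ x, f (act γ x) ∂(vol n) = ∫ x, f x ∂(vol n) := by
  have hinj : Function.Injective (act γ) := fun x y h =>
    Subtype.ext (γ.injective (congrArg Subtype.val h))
  exact (measurePreserving_act γ).integral_comp
    ((continuous_act γ).measurableEmbedding hinj) f

lemma integrable_of_continuous {E : Type*} [NormedAddCommGroup E] {f : Sph n → E}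
    (hf : Continuous f) : Integrable f (vol n) := by
  exact hf.integrable_of_hasCompactSupport (HasCompactSupport.of_compactSpace f)

lemma norm_sph (x : Sph n) : ‖(x : Amb n)‖ = 1 := by simp

lemma inner_sph_self (x : Sph n) : ⟪(x : Amb n), (x : Amb n)⟫ = 1 := by
  rw [real_inner_self_eq_norm_sq, norm_sph]; norm_num

/-! ### The divergence theorem derived from rotation invariance -/

/-- The rotation `exp (t A)` generated by a skew-symmetric operator `A`. -/
noncomputable def rot (A : Amb n →L[ℝ] Amb n) (hA : ∀ x, ⟪A x, x⟫ = 0) (t : ℝ) : OrthGroup n :=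
  LinearIsometry.toLinearIsometryEquiv
    ⟨(NormedSpace.exp (t • A) : Amb n →L[ℝ] Amb n).toLinearMap, fun x => by
      have hd : ∀ t : ℝ, HasDerivAt (fun t : ℝ => (NormedSpace.exp (t • A) : Amb n →L[ℝ] Amb n) x)
          (A ((NormedSpace.exp (t • A) : Amb n →L[ℝ] Amb n) x)) t := fun t => by
        have := (hasDerivAt_exp_smul_const' (𝕂 := ℝ) A t).clm_apply (hasDerivAt_const t x)
        simpa using this
      have h2 : ∀ t : ℝ, HasDerivAt
          (fun t : ℝ => ‖(NormedSpace.exp (t • A) : Amb n →L[ℝ] Amb n) x‖ ^ 2) 0 t := fun t => by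
        have := (hd t).norm_sq
        rwa [real_inner_comm, hA, mul_zero] at this
      have h3 := is_const_of_deriv_eq_zero (fun t => (h2 t).differentiableAt)
        (fun t => (h2 t).deriv) t 0
      rw [zero_smul ℝ A, NormedSpace.exp_zero] at h3
      have h4 := (sq_eq_sq₀ (norm_nonneg _) (norm_nonneg _)).1 h3
      simpa using h4⟩ rfl

lemma rot_apply (A : Amb n →L[ℝ] Amb n) (hA : ∀ x, ⟪A x, x⟫ = 0) (t : ℝ) (x : Amb n) :
    rot A hA t x = (NormedSpace.exp (t • A) : Amb n →L[ℝ] Amb n) x := rfl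

lemma hasDerivAt_rot (A : Amb n →L[ℝ] Amb n) (hA : ∀ x, ⟪A x, x⟫ = 0) (t : ℝ) (x : Amb n) :
    HasDerivAt (fun t => rot A hA t x) (A (rot A hA t x)) t := by
  have := (hasDerivAt_exp_smul_const' (𝕂 := ℝ) A t).clm_apply (hasDerivAt_const t x)
  simpa [rot_apply] using this

/-- The infinitesimal form of the rotation invariance of the surface measure. -/
lemma integral_fderiv_skew (A : Amb n →L[ℝ] Amb n) (hA : ∀ x, ⟪A x, x⟫ = 0)
    (h : Amb n → ℝ) (h' : Amb n → Amb n →L[ℝ] ℝ)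
    (hd : ∀ x : Sph n, HasFDerivAt h (h' x) x) (hc : Continuous fun x : Sph n => h' x) :
    ∫ x : Sph n, h' x (A x) ∂(vol n) = 0 := by
  obtain ⟨C, hC⟩ : ∃ C, ∀ x : Sph n, ‖h' x‖ ≤ C := by
    obtain ⟨C, hC⟩ := (isCompact_range hc).isBounded.exists_norm_le
    exact ⟨C, fun x => hC _ ⟨x, rfl⟩⟩
  have hhc : Continuous fun x : Sph n => h x := continuous_iff_continuousAt.2 fun x =>
    ((hd x).continuousAt.comp (f := ((↑) : Sph n → Amb n)) continuous_subtype_val.continuousAt)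
  have key := hasDerivAt_integral_of_dominated_loc_of_deriv_le (μ := vol n)
    (F := fun t (x : Sph n) => h (act (rot A hA t) x))
    (F' := fun t (x : Sph n) => h' (act (rot A hA t) x) (A (act (rot A hA t) x)))
    (x₀ := (0 : ℝ)) (s := Set.univ) (bound := fun _ => C * ‖A‖) univ_mem
    (Eventually.of_forall fun t => (hhc.comp (continuous_act _)).aestronglyMeasurable)
    (integrable_of_continuous (hhc.comp (continuous_act _)))
    (((hc.comp (continuous_act _)).clm_apply
      (A.continuous.comp (continuous_subtype_val.comp (continuous_act _)))).aestronglyMeasurable)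
    (Eventually.of_forall fun x t _ => by
      refine (ContinuousLinearMap.le_opNorm _ _).trans ?_
      refine mul_le_mul (hC _) ?_ (norm_nonneg _) ((norm_nonneg _).trans (hC x))
      refine (ContinuousLinearMap.le_opNorm _ _).trans ?_
      rw [norm_sph, mul_one])
    (integrable_const _)
    (Eventually.of_forall fun x t _ =>
      (hd (act (rot A hA t) x)).comp_hasDerivAt t (hasDerivAt_rot A hA t x))
  have h1 := key.2
  have h2 : (fun t => ∫ x : Sph n, h (act (rot A hA t) x) ∂(vol n)) =
      fun _ => ∫ x : Sph n, h x ∂(vol n) := by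
    ext t
    exact integral_comp_act (rot A hA t) (fun x : Sph n => h x)
  have h3 := h1.unique (h2 ▸ hasDerivAt_const (0 : ℝ) (∫ x : Sph n, h x ∂(vol n)))
  rw [← h3]
  have h0 : ∀ x : Sph n, act (rot A hA 0) x = x := fun x => by
    apply Subtype.ext
    show rot A hA 0 x = x
    rw [rot_apply, zero_smul ℝ A, NormedSpace.exp_zero]; rfl
  simp only [h0]

/-- The divergence theorem on the sphere for the field `h(x) (b - ⟨b, x⟩ x)`. -/
lemma integral_divergence (b : Amb n) (h : Amb n → ℝ) (h' : Amb n → Amb n →L[ℝ] ℝ)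
    (hd : ∀ x : Sph n, HasFDerivAt h (h' x) x) (hc : Continuous fun x : Sph n => h' x) :
    ∫ x : Sph n, (h' x (b - ⟪b, (x : Amb n)⟫ • (x : Amb n)) - n * ⟪b, (x : Amb n)⟫ * h x) ∂(vol n)
      = 0 := by
  have hhc : Continuous fun x : Sph n => h x := continuous_iff_continuousAt.2 fun x =>
    ((hd x).continuousAt.comp (f := ((↑) : Sph n → Amb n)) continuous_subtype_val.continuousAt)
  let e := EuclideanSpace.basisFun (Fin (n + 1)) ℝ
  -- These generate rotations in the planes of `e j` and `b`. On the sphere `∑ ⟨e j, x⟩ A j x = b -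
  -- ⟨b, x⟩ x`, so the weights `⟨e j, x⟩` recover the desired field; differentiating the weights
  -- produces the term `-n ⟨b, x⟩ h`.
  let A : Fin (n + 1) → Amb n →L[ℝ] Amb n := fun j =>
    (innerSL ℝ (e j)).smulRight b - (innerSL ℝ b).smulRight (e j)
  have hAx : ∀ j x, A j x = ⟪e j, x⟫ • b - ⟪b, x⟫ • e j := fun j x => by simp [A]
  have hA : ∀ j x, ⟪A j x, x⟫ = 0 := fun j x => by
    rw [hAx, inner_sub_left, real_inner_smul_left, real_inner_smul_left]; ring
  let H' : Fin (n + 1) → Amb n → Amb n →L[ℝ] ℝ := fun j x =>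
    ⟪e j, x⟫ • h' x + h x • innerSL ℝ (e j)
  have hH' : ∀ j, Continuous fun x : Sph n => H' j x := fun j => by
    have : Continuous fun x : Sph n => ⟪e j, (x : Amb n)⟫ := by fun_prop
    exact (this.smul hc).add (hhc.smul continuous_const)
  have key : ∀ j, ∫ x : Sph n, H' j x (A j x) ∂(vol n) = 0 := fun j => by
    refine integral_fderiv_skew (A j) (hA j) (fun x => ⟪e j, x⟫ * h x) (H' j) (fun x => ?_) (hH' j)
    exact ((innerSL ℝ (e j)).hasFDerivAt (x := (x : Amb n))).mul (hd x)
  have hsum : ∫ x : Sph n, ∑ j, H' j x (A j x) ∂(vol n) = 0 := by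
    rw [integral_finsetSum]
    · simp [key]
    · intro j _
      exact integrable_of_continuous ((hH' j).clm_apply ((A j).continuous.comp continuous_subtype_val))
  rw [← hsum]
  refine integral_congr_ae (Eventually.of_forall fun x => ?_)
  have e1 : ∑ j, ⟪e j, (x : Amb n)⟫ ^ 2 = 1 := by
    have := e.sum_sq_norm_inner_right (x : Amb n)
    rw [norm_sph] at this
    simpa using this
  have e2 : ∑ j, ⟪e j, (x : Amb n)⟫ • e j = x := e.sum_repr' (x : Amb n)
  have e3 : ∑ j, ⟪e j, (x : Amb n)⟫ * ⟪e j, b⟫ = ⟪b, (x : Amb n)⟫ := by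
    have := e.sum_inner_mul_inner b (x : Amb n)
    rw [← this]
    exact Finset.sum_congr rfl fun j _ => by rw [real_inner_comm b]; ring
  have e4 : ∀ j, ⟪e j, e j⟫ = 1 := fun j => by
    rw [real_inner_self_eq_norm_sq, e.norm_eq_one]; norm_num
  have e5 : ∀ j, H' j x (A j x) = ⟪e j, (x : Amb n)⟫ ^ 2 * h' x b
      - ⟪b, (x : Amb n)⟫ * h' x (⟪e j, (x : Amb n)⟫ • e j)
      + h x * (⟪e j, (x : Amb n)⟫ * ⟪e j, b⟫) - h x * ⟪b, (x : Amb n)⟫ := fun j => by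
    simp only [H', hAx, add_apply, smul_apply, map_sub,
      map_smul, smul_eq_mul, innerSL_apply_apply, e4]
    ring
  simp only [e5]
  rw [Finset.sum_sub_distrib, Finset.sum_add_distrib, Finset.sum_sub_distrib, ← Finset.sum_mul, e1,
    ← Finset.mul_sum, ← map_sum, e2, ← Finset.mul_sum, e3]
  simp
  ring

/-! ### Tangential gradients -/

lemma fact_finrank_amb (n : ℕ) : Fact (Module.finrank ℝ (Amb n) = n + 1) := ⟨by simp⟩

lemma contMDiff_coe_sph {m : WithTop ℕ∞} :
    ContMDiff (𝓡 n) 𝓘(ℝ, Amb n) m (fun y : Sph n => (y : Amb n)) := by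
  have := fact_finrank_amb n
  exact contMDiff_coe_sphere

/-- Tangent vectors at `x` are orthogonal to `x`, so removing the radial part of the ambient
gradient does not change its pairing with them. -/
lemma isGradient_restrict (h : Amb n → ℝ) (D : Sph n → Amb n)
    (hd : ∀ x : Sph n, HasFDerivAt h (innerSL ℝ (D x)) x) :
    IsGradient (fun x : Sph n => h x) fun x => D x - ⟪(x : Amb n), D x⟫ • (x : Amb n) := by
  intro x
  refine ⟨?_, fun v => ?_⟩
  · rw [inner_sub_right, real_inner_smul_right, inner_sph_self]; ring
  have hι : MDifferentiableAt (𝓡 n) 𝓘(ℝ, Amb n) (fun y : Sph n => (y : Amb n)) x :=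
    (contMDiff_coe_sph (m := 1) x).mdifferentiableAt one_ne_zero
  have h1 : mvfderiv (𝓡 n) (fun x : Sph n => h x) x v =
      innerSL ℝ (D x) (mvfderiv (𝓡 n) (fun y : Sph n => (y : Amb n)) x v) := by
    have h1 := mvfderiv_comp_apply (I := 𝓘(ℝ, Amb n)) (I' := 𝓡 n) x
      (g := h) (f := fun y : Sph n => (y : Amb n)) (hd x).differentiableAt.mdifferentiableAt hι v
    have h2 : mvfderiv 𝓘(ℝ, Amb n) h (x : Amb n) = innerSL ℝ (D x) := by
      rw [← (hd x).fderiv, ← mfderiv_eq_fderiv]; rfl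
    rw [h2] at h1
    exact h1
  have h2 : ⟪(x : Amb n), mvfderiv (𝓡 n) (fun y : Sph n => (y : Amb n)) x v⟫ = 0 := by
    have := fact_finrank_amb n
    have : mvfderiv (𝓡 n) (fun y : Sph n => (y : Amb n)) x v ∈
        (ℝ ∙ (x : Amb n))ᗮ := by
      rw [← range_mvfderiv_subtypeVal (n := n) x]
      exact ⟨v, rfl⟩
    exact Submodule.mem_orthogonal_singleton_iff_inner_right.1 this
  rw [h1, inner_sub_left, real_inner_smul_left, h2]
  simp

/-! ### Axial functions and Green's formula -/

/-- The function `x ↦ (1 - ⟨b, x⟩) ^ (-α)`. -/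
noncomputable def axial (b : Amb n) (α : ℝ) (x : Amb n) : ℝ := (1 - ⟪b, x⟫) ^ (-α)

lemma inner_sph_le (b : Amb n) (x : Sph n) : ⟪b, (x : Amb n)⟫ ≤ ‖b‖ := by
  simpa using real_inner_le_norm b (x : Amb n)

lemma abs_inner_sph_le (b : Amb n) (x : Sph n) : |⟪b, (x : Amb n)⟫| ≤ ‖b‖ := by
  simpa using abs_real_inner_le_norm b (x : Amb n)

lemma one_sub_inner_pos {b : Amb n} (hb : ‖b‖ < 1) (x : Sph n) : 0 < 1 - ⟪b, (x : Amb n)⟫ := by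
  linarith [inner_sph_le b x]

lemma axial_pos {b : Amb n} (hb : ‖b‖ < 1) (α : ℝ) (x : Sph n) : 0 < axial b α x :=
  Real.rpow_pos_of_pos (one_sub_inner_pos hb x) _

lemma axial_mul {b : Amb n} (hb : ‖b‖ < 1) (α β : ℝ) (x : Sph n) :
    axial b α x * axial b β x = axial b (α + β) x := by
  rw [axial, axial, axial, ← Real.rpow_add (one_sub_inner_pos hb x)]
  congr 1; ring

lemma axial_add_one {b : Amb n} (hb : ‖b‖ < 1) (α : ℝ) (x : Sph n) :
    (1 - ⟪b, (x : Amb n)⟫) * axial b (α + 1) x = axial b α x := by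
  have : 1 - ⟪b, (x : Amb n)⟫ = axial b (-1) x := by simp [axial]
  rw [this, axial_mul hb]; congr 1; ring

lemma axial_zero_left (α : ℝ) (x : Amb n) : axial 0 α x = 1 := by simp [axial]

lemma continuous_axial {b : Amb n} (hb : ‖b‖ < 1) (α : ℝ) :
    Continuous fun x : Sph n => axial b α x := by
  unfold axial
  refine Continuous.rpow_const (by fun_prop) fun x => Or.inl (one_sub_inner_pos hb x).ne'

lemma hasFDerivAt_axial {b : Amb n} (hb : ‖b‖ < 1) (α : ℝ) (x : Sph n) :
    HasFDerivAt (axial b α) (innerSL ℝ ((α * axial b (α + 1) x) • b)) x := by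
  have h1 : HasFDerivAt (fun x : Amb n => 1 - ⟪b, x⟫) (-(innerSL ℝ b)) (x : Amb n) := by
    simpa using ((innerSL ℝ b).hasFDerivAt (x := (x : Amb n))).const_sub 1
  have h2 := h1.rpow_const (p := -α) (Or.inl (one_sub_inner_pos hb x).ne')
  unfold axial
  refine h2.congr_fderiv ?_
  ext v
  simp only [smul_apply, neg_apply, innerSL_apply_apply, smul_eq_mul, real_inner_smul_left]
  rw [show -(α + 1) = -α - 1 by ring]
  ring

lemma contDiffAt_axial {b : Amb n} (hb : ‖b‖ < 1) (α : ℝ) (x : Sph n) :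
    ContDiffAt ℝ ∞ (axial b α) x := by
  unfold axial
  refine ContDiffAt.rpow_const_of_ne ?_ (one_sub_inner_pos hb x).ne'
  exact contDiffAt_const.sub (contDiffAt_const.inner ℝ contDiffAt_id)

/-- The tangential gradient of `axial b α`. -/
noncomputable def axialGrad (b : Amb n) (α : ℝ) (x : Amb n) : Amb n :=
  (α * axial b (α + 1) x) • (b - ⟪b, x⟫ • x)

lemma continuous_axialGrad {b : Amb n} (hb : ‖b‖ < 1) (α : ℝ) :
    Continuous fun x : Sph n => axialGrad b α x := by
  unfold axialGrad
  have := continuous_axial hb (α + 1)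
  fun_prop

/-- Weak form of the Yamabe equation `-Δv + a_n v = a_n (1 - ‖b‖²) axial b (s + 2)` for `v = axial b
s`, tested against another axial function. -/
lemma integral_green {s : ℝ} (hs : 2 * s = n - 2) {b b' : Amb n} (hb : ‖b‖ < 1) (hb' : ‖b'‖ < 1) :
    ∫ x : Sph n, (⟪axialGrad b s x, axialGrad b' s x⟫ + coeffA n * (axial b s x * axial b' s x))
      ∂(vol n) =
    coeffA n * ((1 - ‖b‖ ^ 2) * ∫ x : Sph n, axial b (s + 2) x * axial b' s x ∂(vol n)) := by
  have c1 := continuous_axial hb (s + 1)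
  have c2 := continuous_axial hb (s + 1 + 1)
  have c3 := continuous_axial hb' s
  have c4 := continuous_axial hb' (s + 1)
  have c5 := continuous_axial hb s
  have c6 := continuous_axial hb (s + 2)
  have c7 := continuous_axialGrad hb s
  have c8 := continuous_axialGrad hb' s
  -- The vector field is `v' ∇v / s` with `v = axial b s` and `v' = axial b' s`.
  have key := integral_divergence b (fun x => axial b' s x * axial b (s + 1) x)
    (fun x => axial b' s x • innerSL ℝ (((s + 1) * axial b (s + 1 + 1) x) • b) +
      axial b (s + 1) x • innerSL ℝ ((s * axial b' (s + 1) x) • b'))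
    (fun x => (hasFDerivAt_axial hb' s x).mul (hasFDerivAt_axial hb (s + 1) x))
    (by
      simp only [map_smul]
      fun_prop)
  have ha : coeffA n = s * (s + 1) := by
    have : (n : ℝ) = 2 * s + 2 := by linarith
    rw [coeffA, this]; ring
  have hns : (n : ℝ) = 2 * (s + 1) := by linarith
  rw [← integral_const_mul, ← integral_const_mul, ← sub_eq_zero, ← integral_sub, ← mul_zero s,
    ← key, ← integral_const_mul]
  · refine integral_congr_ae (Eventually.of_forall fun x => ?_)
    have hx := inner_sph_self x
    have hnb := real_inner_self_eq_norm_sq b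
    have e1 := axial_add_one hb s x
    have e2 := axial_add_one hb (s + 1) x
    have e3 : axial b (s + 2) x = axial b (s + 1 + 1) x := by congr 1; ring
    simp only [axialGrad, add_apply, smul_apply, innerSL_apply_apply,
      real_inner_smul_left, real_inner_smul_right, inner_sub_left, inner_sub_right, hx, hnb,
      smul_eq_mul]
    rw [real_inner_comm b' b, real_inner_comm b' (x : Amb n), e3, ha, hns, ← e1, ← e2]
    ring
  · refine integrable_of_continuous ?_
    fun_prop
  · refine integrable_of_continuous ?_
    fun_prop

/-- Testing the equation with the constant 1, the axial function with `b' = 0`. This fixes the mass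
of the concentrating density `(1 - ‖b‖²) axial b (s + 2)`. -/
lemma integral_axial_add_two (hn : 3 ≤ n) {s : ℝ} (hs : 2 * s = n - 2) {b : Amb n} (hb : ‖b‖ < 1) :
    (1 - ‖b‖ ^ 2) * ∫ x : Sph n, axial b (s + 2) x ∂(vol n) = ∫ x : Sph n, axial b s x ∂(vol n) := by
  have h := integral_green hs hb (b' := 0) (by simp)
  have h3 : (3 : ℝ) ≤ n := by exact_mod_cast hn
  have ha : coeffA n ≠ 0 := by
    unfold coeffA; exact (by nlinarith : (0 : ℝ) < n * (n - 2) / 4).ne'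
  simp only [axial_zero_left, axialGrad, inner_zero_left, zero_smul, sub_zero, smul_zero,
    inner_zero_right, zero_add, mul_one, integral_const_mul] at h
  exact (mul_left_cancel₀ ha h).symm

/-! ### Conformal invariance by differentiation in `r` -/

lemma axial_le_of_le {b : Amb n} {ρ : ℝ} (hρ : ρ < 1) {x : Amb n} (hb : ⟪b, x⟫ ≤ ρ) {α : ℝ}
    (hα : 0 ≤ α) : axial b α x ≤ (1 - ρ) ^ (-α) :=
  Real.rpow_le_rpow_of_nonpos (by linarith) (by linarith) (by linarith)

lemma norm_smul_sph_lt {r : ℝ} (hr : |r| < 1) (p : Sph n) : ‖r • (p : Amb n)‖ < 1 := by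
  rwa [norm_smul, norm_sph, mul_one]

lemma hasDerivAt_integral_axial (p : Sph n) {α : ℝ} (hα : 0 ≤ α) {r : ℝ} (hr : |r| < 1) :
    HasDerivAt (fun r : ℝ => ∫ x : Sph n, axial (r • (p : Amb n)) α x ∂(vol n))
      (∫ x : Sph n, α * (⟪(p : Amb n), (x : Amb n)⟫ * axial (r • (p : Amb n)) (α + 1) x) ∂(vol n))
      r := by
  obtain ⟨ρ, hρ, hρ1⟩ := exists_between hr
  have hball : ∀ r' ∈ {r' : ℝ | |r'| < ρ}, ∀ x : Sph n, ⟪r' • (p : Amb n), (x : Amb n)⟫ ≤ ρ :=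
    fun r' hr' x => (inner_sph_le _ x).trans (by
      rw [norm_smul, norm_sph, mul_one]; exact le_of_lt hr')
  have hlt : ∀ r' ∈ {r' : ℝ | |r'| < ρ}, ‖r' • (p : Amb n)‖ < 1 := fun r' hr' =>
    norm_smul_sph_lt (lt_trans hr' hρ1) p
  have hnhds : {r' : ℝ | |r'| < ρ} ∈ 𝓝 r :=
    (isOpen_lt continuous_abs continuous_const).mem_nhds hρ
  refine (hasDerivAt_integral_of_dominated_loc_of_deriv_le (μ := vol n)
    (F := fun r (x : Sph n) => axial (r • (p : Amb n)) α x)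
    (F' := fun r (x : Sph n) => α * (⟪(p : Amb n), (x : Amb n)⟫ * axial (r • (p : Amb n)) (α + 1) x))
    (x₀ := r) (s := {r' : ℝ | |r'| < ρ}) (bound := fun _ => α * (1 * (1 - ρ) ^ (-(α + 1)))) hnhds
    ?_ ?_ ?_ ?_ (integrable_const _) ?_).2
  · filter_upwards [hnhds] with r' hr'
    exact (continuous_axial (hlt r' hr') α).aestronglyMeasurable
  · exact integrable_of_continuous (continuous_axial (hlt r hρ) α)
  · have := continuous_axial (hlt r hρ) (α + 1)
    exact Continuous.aestronglyMeasurable (by fun_prop)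
  · refine Eventually.of_forall fun x r' hr' => ?_
    rw [norm_mul, norm_mul, Real.norm_of_nonneg hα, Real.norm_of_nonneg (axial_pos (hlt r' hr') _ x).le]
    refine mul_le_mul_of_nonneg_left (mul_le_mul ?_ (axial_le_of_le hρ1 (hball r' hr' x)
      (by linarith)) (axial_pos (hlt r' hr') _ x).le zero_le_one) hα
    simpa using abs_inner_sph_le (p : Amb n) x
  · refine Eventually.of_forall fun x r' hr' => ?_
    have h1 : HasDerivAt (fun r : ℝ => 1 - ⟪r • (p : Amb n), (x : Amb n)⟫)
        (-⟪(p : Amb n), (x : Amb n)⟫) r' := by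
      simp only [real_inner_smul_left]
      simpa using ((hasDerivAt_id r').mul_const ⟪(p : Amb n), (x : Amb n)⟫).const_sub 1
    have h2 := h1.rpow_const (p := -α) (Or.inl (one_sub_inner_pos (hlt r' hr') x).ne')
    unfold axial
    refine h2.congr_deriv ?_
    rw [show -(α + 1) = -α - 1 by ring]; ring

/-- The integrand is, up to the factor `n`, the divergence of `axial (r p) n` times the tangential
part of `p`. Its vanishing makes the normalised critical integral constant in `r`, which replaces a
conformal change of variables. -/
lemma integral_sub_inner_mul_axial (hn : n ≠ 0) (p : Sph n) {r : ℝ} (hr : |r| < 1) :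
    ∫ x : Sph n, (r - ⟪(p : Amb n), (x : Amb n)⟫) * axial (r • (p : Amb n)) (n + 1) x ∂(vol n)
      = 0 := by
  have hb := norm_smul_sph_lt hr p
  have c1 := continuous_axial hb (n + 1)
  have key := integral_divergence (p : Amb n) (axial (r • (p : Amb n)) n)
    (fun x => innerSL ℝ ((n * axial (r • (p : Amb n)) (n + 1) x) • (r • (p : Amb n))))
    (fun x => hasFDerivAt_axial hb n x) (by simp only [map_smul]; fun_prop)
  have hn' : (n : ℝ) ≠ 0 := by exact_mod_cast hn
  apply mul_left_cancel₀ hn'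
  rw [mul_zero, ← key, ← integral_const_mul]
  refine integral_congr_ae (Eventually.of_forall fun x => ?_)
  have e1 := axial_add_one hb n x
  simp only [innerSL_apply_apply, real_inner_smul_left, inner_sub_right, real_inner_smul_right,
    inner_sph_self]
  rw [← e1, real_inner_smul_left]
  ring

/-- The conformal invariance of the critical integral. -/
lemma integral_axial_critical (hn : 3 ≤ n) (p : Sph n) {r : ℝ} (hr : |r| < 1) :
    (1 - r ^ 2) ^ ((n : ℝ) / 2) * ∫ x : Sph n, axial (r • (p : Amb n)) n x ∂(vol n) =
      (vol n).real Set.univ := by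
  set g : ℝ → ℝ := fun r =>
    (1 - r ^ 2) ^ ((n : ℝ) / 2) * ∫ x : Sph n, axial (r • (p : Amb n)) n x ∂(vol n) with hg
  have hd : ∀ r : ℝ, |r| < 1 → HasDerivAt g 0 r := fun r hr => by
    have hpos : 0 < 1 - r ^ 2 := by
      have := (sq_lt_one_iff_abs_lt_one r).2 hr
      linarith
    have hb := norm_smul_sph_lt hr p
    have c1 := continuous_axial hb (n + 1)
    have c0 := continuous_axial hb n
    have h1 : HasDerivAt (fun r : ℝ => (1 - r ^ 2) ^ ((n : ℝ) / 2))
        ((-(2 * r)) * ((n : ℝ) / 2) * (1 - r ^ 2) ^ ((n : ℝ) / 2 - 1)) r := by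
      refine HasDerivAt.rpow_const ?_ (Or.inl hpos.ne')
      simpa using (hasDerivAt_pow 2 r).const_sub 1
    have h2 := h1.mul (hasDerivAt_integral_axial p (Nat.cast_nonneg n) hr)
    refine h2.congr_deriv ?_
    have e0 : (1 - r ^ 2) ^ ((n : ℝ) / 2) = (1 - r ^ 2) ^ ((n : ℝ) / 2 - 1) * (1 - r ^ 2) := by
      rw [← Real.rpow_add_one hpos.ne']; congr 1; ring
    rw [e0]
    have e1 : -(r * ∫ x : Sph n, axial (r • (p : Amb n)) n x ∂(vol n)) + (1 - r ^ 2) *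
        ∫ x : Sph n, (⟪(p : Amb n), (x : Amb n)⟫ * axial (r • (p : Amb n)) (n + 1) x) ∂(vol n)
        = 0 := by
      refine Eq.trans ?_ (neg_eq_zero.2 (integral_sub_inner_mul_axial (by omega) p hr))
      rw [← integral_const_mul, ← integral_const_mul, ← integral_neg, ← integral_neg,
        ← integral_add]
      · refine integral_congr_ae (Eventually.of_forall fun x => ?_)
        have e1 := axial_add_one hb n x
        rw [real_inner_smul_left] at e1
        simp only [← e1]
        ring
      · exact integrable_of_continuous (by fun_prop)
      · exact integrable_of_continuous (by fun_prop)
    rw [integral_const_mul]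
    linear_combination ((n : ℝ) * (1 - r ^ 2) ^ ((n : ℝ) / 2 - 1)) * e1
  have hconst : g r = g 0 := by
    have hconv : Convex ℝ (Set.Ioo (-1 : ℝ) 1) := convex_Ioo _ _
    refine hconv.is_const_of_fderivWithin_eq_zero (𝕜 := ℝ)
      (fun x hx => (hd x (abs_lt.2 hx)).differentiableAt.differentiableWithinAt) (fun x hx => ?_)
      (abs_lt.1 hr) (by simp)
    rw [fderivWithin_of_isOpen isOpen_Ioo hx]
    have := (hd x (abs_lt.2 hx)).hasFDerivAt.fderiv
    rw [this]; ext; simp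
  change g r = _
  rw [hconst, hg]
  simp [axial_zero_left]

/-- The mean value of `axial (r p) α` does not depend on the axis `p`. -/
lemma integral_axial_eq (r α : ℝ) (p q : Sph n) :
    ∫ x : Sph n, axial (r • (p : Amb n)) α x ∂(vol n) =
      ∫ x : Sph n, axial (r • (q : Amb n)) α x ∂(vol n) := by
  let R : OrthGroup n := (ℝ ∙ ((p : Amb n) - q))ᗮ.reflection
  have hR : R p = q := Submodule.reflection_sub (by rw [norm_sph, norm_sph])
  rw [← integral_comp_act R (fun x : Sph n => axial (r • (q : Amb n)) α x)]
  refine integral_congr_ae (Eventually.of_forall fun x => ?_)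
  simp only [axial, real_inner_smul_left]
  have : ⟪(q : Amb n), (act R x : Amb n)⟫ = ⟪(p : Amb n), (x : Amb n)⟫ := by
    rw [← hR]; exact R.inner_map_map _ _
  rw [this]

/-! ### Elementary inequalities for powers -/

/-- If any two of the `U k` have a common small part, then a power of the sum is
almost additive. -/
lemma rpow_sum_rpow_le {ι : Type*} [Fintype ι] (U : ι → ℝ) (hU : ∀ k, 0 < U k) {q M : ℝ}
    (hq : 1 ≤ q) (hM : 0 ≤ M) (hUM : ∀ k l, k ≠ l → min (U k) (U l) ≤ M) :
    (∑ k, U k ^ q) ^ ((q + 1) / q) ≤ ∑ k, U k ^ (q + 1) +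
      (Fintype.card ι + 2) * (Fintype.card ι * M ^ q) * ∑ k, U k := by
  classical
  have hq0 : 0 < q := by linarith
  rcases isEmpty_or_nonempty ι with hι | hι
  · simp [Real.zero_rpow (div_pos (by linarith : 0 < q + 1) hq0).ne']
  obtain ⟨k, hk⟩ := Finite.exists_max U
  have hle : ∀ l ∈ Finset.univ.erase k, U l ≤ M := fun l hl => by
    have := hUM k l (Finset.ne_of_mem_erase hl).symm
    rwa [min_eq_right (hk l)] at this
  set N : ℝ := (Fintype.card ι : ℝ)
  set T := U k ^ q with hT
  set R := ∑ l ∈ Finset.univ.erase k, U l ^ q with hR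
  have hT0 : 0 < T := Real.rpow_pos_of_pos (hU k) _
  have hR0 : 0 ≤ R := Finset.sum_nonneg fun l _ => (Real.rpow_pos_of_pos (hU l) _).le
  have hcard : ((Finset.univ.erase k).card : ℝ) ≤ N := by
    have : (Finset.univ.erase k).card ≤ Fintype.card ι :=
      Finset.card_erase_le.trans_eq Finset.card_univ
    exact Nat.cast_le.2 this
  have hRM : R ≤ N * M ^ q := by
    refine (Finset.sum_le_card_nsmul _ _ (M ^ q) fun l hl =>
      Real.rpow_le_rpow (hU l).le (hle l hl) hq0.le).trans ?_
    rw [nsmul_eq_mul]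
    exact mul_le_mul_of_nonneg_right hcard (Real.rpow_nonneg hM _)
  have hRT : R ≤ N * T := by
    refine (Finset.sum_le_card_nsmul _ _ T fun l hl =>
      Real.rpow_le_rpow (hU l).le (hk l) hq0.le).trans ?_
    rw [nsmul_eq_mul]
    exact mul_le_mul_of_nonneg_right hcard hT0.le
  have hsum : ∑ k, U k ^ q = T * (1 + R / T) := by
    rw [← Finset.add_sum_erase _ _ (Finset.mem_univ k), mul_add, mul_one,
      mul_div_cancel₀ _ hT0.ne']
  have hρ0 : 0 ≤ R / T := div_nonneg hR0 hT0.le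
  have hρN : R / T ≤ N := (div_le_iff₀ hT0).2 hRT
  have hTP : T ^ ((q + 1) / q) = U k ^ (q + 1) := by
    rw [hT, ← Real.rpow_mul (hU k).le]; congr 1; field_simp
  -- The exponent is at most 2 because `q ≥ 1`, and `t = R / T ≤ N` allows `(1 + t)² ≤ 1 + (N + 2)
  -- t`.
  have h1 : (1 + R / T) ^ ((q + 1) / q) ≤ 1 + (N + 2) * (R / T) := by
    calc (1 + R / T) ^ ((q + 1) / q) ≤ (1 + R / T) ^ (2 : ℝ) := by
          refine Real.rpow_le_rpow_of_exponent_le (by linarith) ?_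
          rw [div_le_iff₀ hq0]; linarith
      _ = (1 + R / T) ^ 2 := by norm_cast
      _ ≤ 1 + (N + 2) * (R / T) := by nlinarith
  have hUsplit : U k ^ (q + 1) = T * U k := by rw [Real.rpow_add_one (hU k).ne']
  have hUk : U k ≤ ∑ k, U k := Finset.single_le_sum (fun l _ => (hU l).le) (Finset.mem_univ k)
  have hUk2 : U k ^ (q + 1) ≤ ∑ k, U k ^ (q + 1) :=
    Finset.single_le_sum (f := fun k => U k ^ (q + 1))
      (fun l _ => (Real.rpow_pos_of_pos (hU l) _).le) (Finset.mem_univ k)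
  have hN : 0 ≤ N := Nat.cast_nonneg _
  rw [hsum, Real.mul_rpow hT0.le (by linarith), hTP]
  calc U k ^ (q + 1) * (1 + R / T) ^ ((q + 1) / q)
      ≤ U k ^ (q + 1) * (1 + (N + 2) * (R / T)) :=
        mul_le_mul_of_nonneg_left h1 (Real.rpow_nonneg (hU k).le _)
    _ = U k ^ (q + 1) + (N + 2) * R * U k := by rw [hUsplit]; field_simp
    _ ≤ _ := by
      refine add_le_add hUk2 (mul_le_mul ?_ hUk (hU k).le ?_)
      · exact mul_le_mul_of_nonneg_left hRM (by linarith)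
      · exact mul_nonneg (by linarith) (mul_nonneg hN (Real.rpow_nonneg hM _))

/-- After division by powers of `S`, with `z = Y / S`, this compares `(1 + z/4)^((ν+2)/2)` with `(1
+ z)^(ν/2)`. A quarter of the gain is affordable as a loss: the left side stays below `1 +
(ν+2)z/4`, the right side is at least `1 + νz/2`, and `ν > 2`. -/
lemma rpow_lt_mul_rpow_of_gap {ν S Y E W : ℝ} (hν : 3 ≤ ν) (hS : 0 < S) (hY : 0 < Y)
    (hE : S + Y ≤ E) (hW0 : 0 ≤ W) (hW : W ≤ S + Y / 4) (hYS : (ν + 2) * Y ≤ 8 * S) :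
    W ^ ((ν + 2) / 2) < S * E ^ (ν / 2) := by
  set z := Y / S with hz
  have hz0 : 0 < z := div_pos hY hS
  have hYz : Y = S * z := by rw [hz]; field_simp
  have hz1 : (ν + 2) * z ≤ 8 := by
    rw [hz, ← mul_div_assoc, div_le_iff₀ hS]; exact hYS
  have h1 : W ^ ((ν + 2) / 2) ≤ S ^ ((ν + 2) / 2) * (1 + z / 4) ^ ((ν + 2) / 2) := by
    rw [← Real.mul_rpow hS.le (by positivity)]
    exact Real.rpow_le_rpow hW0 (by rw [hYz] at hW; linarith) (by linarith)
  have h2 : S ^ (ν / 2) * (1 + z) ^ (ν / 2) ≤ E ^ (ν / 2) := by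
    rw [← Real.mul_rpow hS.le (by positivity)]
    exact Real.rpow_le_rpow (by positivity) (by rw [hYz] at hE; linarith) (by linarith)
  have h3 : 1 + ν / 2 * z ≤ (1 + z) ^ (ν / 2) :=
    one_add_mul_self_le_rpow_one_add (by linarith) (by linarith)
  have h4 : (1 + z / 4) ^ ((ν + 2) / 2) < 1 + ν / 2 * z := by
    set t := z / 4 * ((ν + 2) / 2) with ht
    have ht0 : 0 ≤ t := by positivity
    have ht1 : t ≤ 1 := by rw [ht]; linarith
    calc (1 + z / 4) ^ ((ν + 2) / 2) ≤ Real.exp (z / 4) ^ ((ν + 2) / 2) :=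
          Real.rpow_le_rpow (by positivity) (by linarith [Real.add_one_le_exp (z / 4)])
            (by linarith)
      _ = Real.exp t := (Real.exp_mul _ _).symm
      _ ≤ 1 + t + t ^ 2 := by
          have := (abs_le.1 (Real.abs_exp_sub_one_sub_id_le (abs_le.2 ⟨by linarith, ht1⟩))).2
          linarith
      _ ≤ 1 + 2 * t := by nlinarith
      _ < 1 + ν / 2 * z := by rw [ht]; nlinarith
  have hS2 : S ^ ((ν + 2) / 2) = S * S ^ (ν / 2) := by
    rw [show (ν + 2) / 2 = 1 + ν / 2 by ring, Real.rpow_add hS, Real.rpow_one]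
  calc W ^ ((ν + 2) / 2) ≤ S * S ^ (ν / 2) * (1 + z / 4) ^ ((ν + 2) / 2) := hS2 ▸ h1
    _ < S * S ^ (ν / 2) * (1 + z) ^ (ν / 2) :=
        mul_lt_mul_of_pos_left (h4.trans_le h3) (mul_pos hS (Real.rpow_pos_of_pos hS _))
    _ = S * (S ^ (ν / 2) * (1 + z) ^ (ν / 2)) := by ring
    _ ≤ _ := mul_le_mul_of_nonneg_left h2 hS.le

/-! ### Concentration and pairwise interaction -/

lemma smul_inner_le_of_dist {p x : Sph n} {ρ r : ℝ} (hρ : 0 ≤ ρ) (hx : ρ ≤ dist x p)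
    (hr0 : 0 ≤ r) (hr1 : r ≤ 1) : ⟪r • (p : Amb n), (x : Amb n)⟫ ≤ 1 - min (ρ ^ 2 / 2) 1 := by
  rw [real_inner_smul_left]
  have h1 : dist x p ^ 2 = 2 - 2 * ⟪(p : Amb n), (x : Amb n)⟫ := by
    rw [Subtype.dist_eq, dist_eq_norm, norm_sub_sq_real, norm_sph, norm_sph, real_inner_comm]; ring
  have h2 : ρ ^ 2 ≤ dist x p ^ 2 := pow_le_pow_left₀ hρ hx 2
  rcases le_total 0 ⟪(p : Amb n), (x : Amb n)⟫ with h | h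
  · have := min_le_left (ρ ^ 2 / 2) 1
    nlinarith
  · have := min_le_right (ρ ^ 2 / 2) 1
    nlinarith

lemma axial_le_of_dist {p x : Sph n} {ρ r α : ℝ} (hρ : 0 < ρ) (hx : ρ ≤ dist x p)
    (hr0 : 0 ≤ r) (hr1 : r ≤ 1) (hα : 0 ≤ α) :
    axial (r • (p : Amb n)) α x ≤ (min (ρ ^ 2 / 2) 1) ^ (-α) := by
  have hτ : 0 < min (ρ ^ 2 / 2) 1 := lt_min (by positivity) one_pos
  have := axial_le_of_le (by linarith) (smul_inner_le_of_dist hρ.le hx hr0 hr1) hα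
  simpa using this

/-- Every `x` is at distance at least `dist p q / 2` from `p` or from `q`, and the function with
that axis is bounded there uniformly in `r`. -/
lemma exists_min_axial_le {p q : Sph n} (hpq : p ≠ q) {α : ℝ} (hα : 0 ≤ α) :
    ∃ C : ℝ, ∀ r : ℝ, 0 ≤ r → r ≤ 1 → ∀ x : Sph n,
      min (axial (r • (p : Amb n)) α x) (axial (r • (q : Amb n)) α x) ≤ C := by
  have hd : 0 < dist p q / 2 := half_pos (dist_pos.2 hpq)
  refine ⟨(min ((dist p q / 2) ^ 2 / 2) 1) ^ (-α), fun r hr0 hr1 x => ?_⟩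
  by_cases h : dist p q / 2 ≤ dist x p
  · exact (min_le_left _ _).trans (axial_le_of_dist hd h hr0 hr1 hα)
  · refine (min_le_right _ _).trans (axial_le_of_dist hd ?_ hr0 hr1 hα)
    have := dist_triangle p x q
    rw [dist_comm p x] at this
    linarith

lemma vol_le_integral_axial {s : ℝ} (hs : 0 ≤ s) (p : Sph n) {r : ℝ} (hr0 : 0 ≤ r) (hr1 : r < 1) :
    (2 : ℝ) ^ (-s) * (vol n).real Set.univ ≤ ∫ x : Sph n, axial (r • (p : Amb n)) s x ∂(vol n) := by
  have hb := norm_smul_sph_lt (abs_lt.2 ⟨by linarith, hr1⟩) p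
  have : ∫ _ : Sph n, (2 : ℝ) ^ (-s) ∂(vol n) = (2 : ℝ) ^ (-s) * (vol n).real Set.univ := by
    simp [mul_comm]
  rw [← this]
  refine integral_mono (integrable_const _) (integrable_of_continuous (continuous_axial hb s))
    fun x => ?_
  refine Real.rpow_le_rpow_of_nonpos (one_sub_inner_pos hb x) ?_ (by linarith)
  have := (abs_le.1 (abs_inner_sph_le (r • (p : Amb n)) x)).1
  linarith

lemma vol_pos (n : ℕ) : 0 < (vol n).real Set.univ := by
  have : vol n ≠ 0 := Measure.toSphere_ne_zero _
  have : NeZero (vol n) := ⟨this⟩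
  exact measureReal_univ_pos

lemma one_sub_inner_pos_of_ne {p q : Sph n} (hpq : p ≠ q) :
    0 < 1 - ⟪(p : Amb n), (q : Amb n)⟫ := by
  have h1 := inner_lt_one_iff_real_of_norm_eq_one (norm_sph p) (norm_sph q)
  have := h1.2 fun h => hpq (Subtype.ext h)
  linarith

/-- The weighted mean of `f` against a concentrating axial function, compared with a constant. -/
lemma abs_integral_axial_mul_sub_le (hn : 3 ≤ n) {s : ℝ} (hs : 2 * s = n - 2) (p q : Sph n)
    {r C D η : ℝ} (hr0 : 0 ≤ r) (hr1 : r < 1)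
    (hpt : ∀ x : Sph n,
      |axial (r • (p : Amb n)) (s + 2) x * (axial (r • (q : Amb n)) s x - D)| ≤
      η * axial (r • (p : Amb n)) (s + 2) x + C * (axial (r • (q : Amb n)) s x + D)) :
    |(1 - r ^ 2) * ∫ x : Sph n, axial (r • (p : Amb n)) (s + 2) x * axial (r • (q : Amb n)) s x
          ∂(vol n) -
        (∫ x : Sph n, axial (r • (p : Amb n)) s x ∂(vol n)) * D| ≤
      η * (∫ x : Sph n, axial (r • (p : Amb n)) s x ∂(vol n)) + (1 - r ^ 2) *
        (C * ((∫ x : Sph n, axial (r • (p : Amb n)) s x ∂(vol n)) + D * (vol n).real Set.univ)) := by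
  have habs : |r| < 1 := abs_lt.2 ⟨by linarith, hr1⟩
  have hp := norm_smul_sph_lt habs p
  have hq := norm_smul_sph_lt habs q
  have c1 := continuous_axial hp (s + 2)
  have c2 := continuous_axial hq s
  have he : 0 < 1 - r ^ 2 := by
    have := (sq_lt_one_iff_abs_lt_one r).2 habs; linarith
  have hc := integral_axial_add_two hn hs hp
  have hcq := integral_axial_eq r s p q
  rw [norm_smul, norm_sph, mul_one, Real.norm_eq_abs, sq_abs] at hc
  have i1 := integrable_of_continuous c1
  have i2 := integrable_of_continuous c2
  have i3 : Integrable (fun x : Sph n => axial (r • (p : Amb n)) (s + 2) x *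
      axial (r • (q : Amb n)) s x) (vol n) := integrable_of_continuous (c1.mul c2)
  have i4 : Integrable (fun x : Sph n => axial (r • (q : Amb n)) s x + D) (vol n) :=
    i2.add (integrable_const D)
  have hmain : (1 - r ^ 2) * ∫ x : Sph n, axial (r • (p : Amb n)) (s + 2) x *
      axial (r • (q : Amb n)) s x ∂(vol n) -
      (∫ x : Sph n, axial (r • (p : Amb n)) s x ∂(vol n)) * D = (1 - r ^ 2) *
      ∫ x : Sph n, axial (r • (p : Amb n)) (s + 2) x * (axial (r • (q : Amb n)) s x - D)
        ∂(vol n) := by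
    rw [← hc]
    simp only [mul_sub]
    rw [integral_sub i3 (i1.mul_const D), integral_mul_const]
    ring
  have hint : |∫ x : Sph n, axial (r • (p : Amb n)) (s + 2) x * (axial (r • (q : Amb n)) s x - D)
      ∂(vol n)| ≤ ∫ x : Sph n, (η * axial (r • (p : Amb n)) (s + 2) x +
        C * (axial (r • (q : Amb n)) s x + D)) ∂(vol n) := by
    refine (abs_integral_le_integral_abs).trans ?_
    refine integral_mono (integrable_of_continuous ?_) ?_ hpt
    · exact (c1.mul (c2.sub continuous_const)).abs
    · exact (i1.const_mul η).add (i4.const_mul C)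
  rw [integral_add (i1.const_mul η) (i4.const_mul C),
    integral_const_mul, integral_const_mul, integral_add i2 (integrable_const _), ← hcq,
    integral_const, smul_eq_mul, mul_comm _ D] at hint
  rw [hmain, abs_mul, abs_of_pos he]
  refine (mul_le_mul_of_nonneg_left hint he.le).trans_eq ?_
  rw [← hc]; ring

/-- The interaction of two bubbles concentrating at distinct points. -/
lemma eventually_interaction (hn : 3 ≤ n) {s : ℝ} (hs : 2 * s = n - 2) {p q : Sph n} (hpq : p ≠ q)
    {η : ℝ} (hη : 0 < η) :
    ∀ᶠ r : ℝ in 𝓝[<] 1,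
      |(1 - r ^ 2) * ∫ x : Sph n, axial (r • (p : Amb n)) (s + 2) x * axial (r • (q : Amb n)) s x
          ∂(vol n) -
        (∫ x : Sph n, axial (r • (p : Amb n)) s x ∂(vol n)) *
          (1 - ⟪(p : Amb n), (q : Amb n)⟫) ^ (-s)| ≤
      η * ∫ x : Sph n, axial (r • (p : Amb n)) s x ∂(vol n) := by
  have h3 : (3 : ℝ) ≤ n := by exact_mod_cast hn
  have hs0 : 0 < s := by linarith
  have hD0 := one_sub_inner_pos_of_ne hpq
  set D := (1 - ⟪(p : Amb n), (q : Amb n)⟫) ^ (-s) with hD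
  have hDpos : 0 < D := Real.rpow_pos_of_pos hD0 _
  obtain ⟨ε, hε, ρ, hρ, hnear⟩ : ∃ ε > 0, ∃ ρ > 0, ∀ r : ℝ, dist r 1 < ε → ∀ x : Sph n,
      dist x p < ρ → |axial (r • (q : Amb n)) s x - D| ≤ η / 2 := by
    have hc : ContinuousAt (fun z : ℝ × Sph n => axial (z.1 • (q : Amb n)) s z.2) (1, p) := by
      unfold axial
      refine ContinuousAt.rpow_const (Continuous.continuousAt (by fun_prop)) (Or.inl ?_)
      simp only [one_smul]
      rw [real_inner_comm]; exact hD0.ne'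
    have hD' : axial ((1 : ℝ) • (q : Amb n)) s p = D := by
      rw [one_smul, axial, real_inner_comm]
    obtain ⟨δ, hδ, h⟩ := Metric.continuousAt_iff.1 hc (η / 2) (half_pos hη)
    refine ⟨δ, hδ, δ, hδ, fun r hr x hx => ?_⟩
    have := h (x := (r, x)) (by rw [Prod.dist_eq]; exact max_lt hr hx)
    simp only [hD', Real.dist_eq] at this
    exact this.le
  set C := (min (ρ ^ 2 / 2) 1) ^ (-(s + 2)) with hC
  have hC0 : 0 ≤ C := Real.rpow_nonneg (le_min (by positivity) zero_le_one) _
  have e1 : ∀ᶠ r : ℝ in 𝓝[<] 1, (1 - r ^ 2) * (C * (1 + D * 2 ^ s)) < η / 2 := by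
    have : Tendsto (fun r : ℝ => (1 - r ^ 2) * (C * (1 + D * 2 ^ s))) (𝓝[<] 1) (𝓝 0) := by
      have hc : Continuous fun r : ℝ => (1 - r ^ 2) * (C * (1 + D * 2 ^ s)) := by fun_prop
      have := hc.tendsto 1
      simp only [one_pow, sub_self, zero_mul] at this
      exact this.mono_left nhdsWithin_le_nhds
    exact this.eventually (gt_mem_nhds (half_pos hη))
  have e2 : ∀ᶠ r : ℝ in 𝓝[<] 1, dist r 1 < ε :=
    nhdsWithin_le_nhds (Metric.ball_mem_nhds 1 hε)
  filter_upwards [e1, e2, Ioo_mem_nhdsLT (zero_lt_one (α := ℝ))] with r hr1 hr2 hr3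
  have habs : |r| < 1 := abs_lt.2 ⟨by linarith [hr3.1], hr3.2⟩
  have hp := norm_smul_sph_lt habs p
  have hq := norm_smul_sph_lt habs q
  have he : 0 < 1 - r ^ 2 := by
    have := (sq_lt_one_iff_abs_lt_one r).2 habs; linarith
  have hcv := vol_le_integral_axial hs0.le p hr3.1.le hr3.2
  set c := ∫ x : Sph n, axial (r • (p : Amb n)) s x ∂(vol n) with hcdef
  -- All errors are measured relative to `c`; this lower bound on `c` absorbs the constant ones, and
  -- no limit of `c` is needed.
  have hV : (vol n).real Set.univ ≤ 2 ^ s * c := by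
    have h2 : (2 : ℝ) ^ s * 2 ^ (-s) = 1 := by
      rw [← Real.rpow_add two_pos]; simp
    calc (vol n).real Set.univ = 2 ^ s * (2 ^ (-s) * (vol n).real Set.univ) := by
          rw [← mul_assoc, h2, one_mul]
      _ ≤ _ := mul_le_mul_of_nonneg_left hcv (by positivity)
  have hcpos : 0 < c := lt_of_lt_of_le (mul_pos (by positivity) (vol_pos n)) hcv
  have hpt : ∀ x : Sph n, |axial (r • (p : Amb n)) (s + 2) x * (axial (r • (q : Amb n)) s x - D)| ≤
      η / 2 * axial (r • (p : Amb n)) (s + 2) x + C * (axial (r • (q : Amb n)) s x + D) := fun x => by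
    have a1 := axial_pos hp (s + 2) x
    have a2 := axial_pos hq s x
    rw [abs_mul, abs_of_pos a1]
    -- Near `p` the second function is within `η / 2` of its limit `D`; away from `p` the first
    -- factor is at most `C`, a contribution that the prefactor `1 - r²` later kills.
    by_cases hx : dist x p < ρ
    · have := hnear r hr2 x hx
      have h' : 0 ≤ C * (axial (r • (q : Amb n)) s x + D) := by positivity
      nlinarith
    · have h1 := axial_le_of_dist hρ (not_lt.1 hx) hr3.1.le hr3.2.le (by linarith : 0 ≤ s + 2)
      have h2 : |axial (r • (q : Amb n)) s x - D| ≤ axial (r • (q : Amb n)) s x + D := by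
        rw [abs_le]; constructor <;> linarith
      have := mul_le_mul h1 h2 (abs_nonneg _) hC0
      nlinarith
  calc _ ≤ η / 2 * c + (1 - r ^ 2) * (C * (c + D * (vol n).real Set.univ)) :=
        abs_integral_axial_mul_sub_le hn hs p q hr3.1.le hr3.2 hpt
    _ ≤ η / 2 * c + (1 - r ^ 2) * (C * (c + D * (2 ^ s * c))) :=
        add_le_add_right (mul_le_mul_of_nonneg_left (mul_le_mul_of_nonneg_left
          (add_le_add_right (mul_le_mul_of_nonneg_left hV hDpos.le) _) hC0) he.le) _
    _ = η / 2 * c + ((1 - r ^ 2) * (C * (1 + D * 2 ^ s))) * c := by ring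
    _ ≤ η / 2 * c + η / 2 * c :=
        add_le_add_right (mul_le_mul_of_nonneg_right hr1.le hcpos.le) _
    _ = η * c := by ring

/-! ### Normalised bubbles -/

/-- The bubble with axis `p`, normalised so that it solves the Yamabe equation of the sphere
for `s = (n - 2) / 2`. -/
noncomputable def bubble (s r : ℝ) (p : Sph n) (x : Amb n) : ℝ :=
  (1 - r ^ 2) ^ (s / 2) * axial (r • (p : Amb n)) s x

section Bubble

variable {s r : ℝ}

lemma one_sub_sq_pos (hr : |r| < 1) : 0 < 1 - r ^ 2 := by
  have := (sq_lt_one_iff_abs_lt_one r).2 hr; linarith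

lemma bubble_pos (hr : |r| < 1) (p x : Sph n) : 0 < bubble s r p x :=
  mul_pos (Real.rpow_pos_of_pos (one_sub_sq_pos hr) _) (axial_pos (norm_smul_sph_lt hr p) _ x)

lemma continuous_bubble (hr : |r| < 1) (p : Sph n) : Continuous fun x : Sph n => bubble s r p x :=
  continuous_const.mul (continuous_axial (norm_smul_sph_lt hr p) s)

lemma continuous_bubble_rpow (hr : |r| < 1) (p : Sph n) (q : ℝ) :
    Continuous fun x : Sph n => bubble s r p x ^ q :=
  (continuous_bubble hr p).rpow_const fun x => Or.inl (bubble_pos hr p x).ne'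

lemma bubble_rpow (hr : |r| < 1) (p x : Sph n) (q : ℝ) :
    bubble s r p x ^ q = (1 - r ^ 2) ^ (s / 2 * q) * axial (r • (p : Amb n)) (s * q) x := by
  have h1 := one_sub_sq_pos hr
  have h2 := one_sub_inner_pos (norm_smul_sph_lt hr p) x
  rw [bubble, Real.mul_rpow (Real.rpow_nonneg h1.le _) (axial_pos (norm_smul_sph_lt hr p) _ x).le,
    ← Real.rpow_mul h1.le, axial, axial, ← Real.rpow_mul h2.le, neg_mul]

lemma bubble_rpow_dual (hs : 0 < s) (hr : |r| < 1) (p x : Sph n) :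
    bubble s r p x ^ ((s + 2) / s) =
      (1 - r ^ 2) ^ (s / 2) * (1 - r ^ 2) * axial (r • (p : Amb n)) (s + 2) x := by
  have h1 := one_sub_sq_pos hr
  rw [bubble_rpow hr, ← Real.rpow_add_one h1.ne']
  congr 2 <;> field_simp

lemma integral_bubble_critical (hn : 3 ≤ n) (hs : 2 * s = n - 2) (hr : |r| < 1) (p : Sph n) :
    ∫ x : Sph n, bubble s r p x ^ ((s + 2) / s + 1) ∂(vol n) = (vol n).real Set.univ := by
  have h3 : (3 : ℝ) ≤ n := by exact_mod_cast hn
  have hs0 : 0 < s := by linarith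
  rw [← integral_axial_critical hn p hr, ← integral_const_mul]
  refine integral_congr_ae (Eventually.of_forall fun x => ?_)
  simp only [bubble_rpow hr]
  have hn2 : (n : ℝ) = 2 * s + 2 := by linarith
  rw [hn2]
  congr 2 <;> field_simp <;> ring

/-- Integrate `U ≤ 1 + U^(q+1)`. The crude bound serves only to show that `δ² c → 0`. -/
lemma integral_bubble_le (hn : 3 ≤ n) (hs : 2 * s = n - 2) (hr : |r| < 1) (p : Sph n) :
    ∫ x : Sph n, bubble s r p x ∂(vol n) ≤ 2 * (vol n).real Set.univ := by
  have h3 : (3 : ℝ) ≤ n := by exact_mod_cast hn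
  have hs0 : 0 < s := by linarith
  have hq : 1 ≤ (s + 2) / s + 1 := by
    have : 0 ≤ (s + 2) / s := by positivity
    linarith
  have i1 := integrable_of_continuous (continuous_bubble_rpow (s := s) hr p ((s + 2) / s + 1))
  have : ∫ x : Sph n, (1 + bubble s r p x ^ ((s + 2) / s + 1)) ∂(vol n) =
      2 * (vol n).real Set.univ := by
    rw [integral_add (integrable_const _) i1, integral_bubble_critical hn hs hr, integral_const,
      smul_eq_mul]
    ring
  rw [← this]
  refine integral_mono (integrable_of_continuous (continuous_bubble hr p))
    ((integrable_const _).add i1) fun x => ?_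
  have h0 := bubble_pos (s := s) hr p x
  rcases le_total (bubble s r p x) 1 with h | h
  · have := Real.rpow_nonneg h0.le ((s + 2) / s + 1)
    linarith
  · have := Real.self_le_rpow_of_one_le h hq
    linarith

lemma integral_bubble_interaction (hs : 0 < s) (hr : |r| < 1) (p p' : Sph n) :
    ∫ x : Sph n, bubble s r p x ^ ((s + 2) / s) * bubble s r p' x ∂(vol n) =
      ((1 - r ^ 2) ^ (s / 2)) ^ 2 * ((1 - r ^ 2) *
        ∫ x : Sph n, axial (r • (p : Amb n)) (s + 2) x * axial (r • (p' : Amb n)) s x ∂(vol n)) := by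
  rw [← integral_const_mul, ← integral_const_mul]
  refine integral_congr_ae (Eventually.of_forall fun x => ?_)
  simp only [bubble_rpow_dual hs hr]
  rw [bubble]; ring

end Bubble

/-! ### Signed sums of bubbles and the dual quotient -/

section BubbleSum

variable {ι : Type*} [Fintype ι]

lemma sum_sum_eq_card_add [DecidableEq ι] (σ : ι → ℝ) (hσ : ∀ k, σ k ^ 2 = 1) (I : ι → ι → ℝ) (v : ℝ)
    (hI : ∀ k, I k k = v) :
    ∑ k, ∑ l, σ k * σ l * I k l =
      Fintype.card ι * v + ∑ k, ∑ l, if k ≠ l then σ k * σ l * I k l else 0 := by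
  have h : ∀ k l, σ k * σ l * I k l =
      (if k = l then v else 0) + if k ≠ l then σ k * σ l * I k l else 0 := fun k l => by
    by_cases hkl : k = l
    · subst hkl
      simp only [if_true, ne_eq, not_true_eq_false, if_false, add_zero, hI, ← sq, hσ, one_mul]
    · simp [hkl]
  rw [Finset.sum_congr rfl fun k _ => Finset.sum_congr rfl fun l _ => h k l]
  simp only [Finset.sum_add_distrib]
  simp

lemma sum_interaction_ge [DecidableEq ι] (σ : ι → ℝ) (hσ : ∀ k, σ k ^ 2 = 1) (J D : ι → ι → ℝ)
    {c η : ℝ} (hη : 0 ≤ η * c) (hJ : ∀ k l, k ≠ l → |J k l - c * D k l| ≤ η * c) :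
    c * (∑ k, ∑ l, if k ≠ l then σ k * σ l * D k l else 0) - Fintype.card ι ^ 2 * (η * c) ≤
      ∑ k, ∑ l, if k ≠ l then σ k * σ l * J k l else 0 := by
  have h : ∀ k l, c * (if k ≠ l then σ k * σ l * D k l else 0) - η * c ≤
      if k ≠ l then σ k * σ l * J k l else 0 := fun k l => by
    by_cases hkl : k = l
    · simp [hkl, hη]
    · have h1 : |σ k * σ l| = 1 := by
        rw [← sq_eq_sq₀ (abs_nonneg _) zero_le_one, sq_abs, mul_pow, hσ, hσ]; norm_num
      have h2 : |σ k * σ l * (J k l - c * D k l)| ≤ η * c := by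
        rw [abs_mul, h1, one_mul]; exact hJ k l hkl
      have := (abs_le.1 h2).1
      simp only [ne_eq, hkl, not_false_eq_true, if_true]
      linarith
  calc _ = ∑ k : ι, ∑ l : ι, (c * (if k ≠ l then σ k * σ l * D k l else 0) - η * c) := by
        simp only [Finset.sum_sub_distrib, ← Finset.mul_sum, Finset.sum_const, Finset.card_univ,
          nsmul_eq_mul]
        ring
    _ ≤ _ := Finset.sum_le_sum fun k _ => Finset.sum_le_sum fun l _ => h k l

variable {s : ℝ}

lemma integral_dual_pairing (P : ι → Sph n) (σ : ι → ℝ) {r : ℝ} (hr : |r| < 1) :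
    ∫ x : Sph n, (∑ k, σ k * bubble s r (P k) x) * (∑ k, σ k * bubble s r (P k) x ^ ((s + 2) / s))
      ∂(vol n) =
    ∑ k, ∑ l, σ k * σ l *
      ∫ x : Sph n, bubble s r (P k) x ^ ((s + 2) / s) * bubble s r (P l) x ∂(vol n) := by
  have hi : ∀ k l, Integrable (fun x : Sph n => bubble s r (P k) x ^ ((s + 2) / s) *
      bubble s r (P l) x) (vol n) := fun k l =>
    integrable_of_continuous ((continuous_bubble_rpow hr (P k) _).mul (continuous_bubble hr (P l)))
  simp only [← integral_const_mul]
  rw [Finset.sum_congr rfl fun k _ => (integral_finsetSum Finset.univ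
    fun l _ => (hi k l).const_mul (σ k * σ l)).symm, ← integral_finsetSum Finset.univ
    fun k _ => integrable_finsetSum _ fun l _ => (hi k l).const_mul (σ k * σ l)]
  refine integral_congr_ae (Eventually.of_forall fun x => ?_)
  simp only
  rw [Finset.sum_mul_sum, Finset.sum_comm]
  refine Finset.sum_congr rfl fun k _ => Finset.sum_congr rfl fun l _ => ?_
  ring

/-- Apply `rpow_sum_rpow_le` pointwise with `M = δ C`. Since `δ^q = δ (1 - r²)` and each bubble has
integral `δ c`, the error carries a factor `1 - r²` beyond the interaction scale `δ² c`. -/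
lemma integral_dual_norm_le (hn : 3 ≤ n) (hs : 2 * s = n - 2) (P : ι → Sph n) (σ : ι → ℝ)
    (hσ : ∀ k, σ k ^ 2 = 1) {C r c : ℝ} (hr0 : 0 ≤ r) (hr1 : r < 1) (hC0 : 0 ≤ C)
    (hC : ∀ k l, k ≠ l → ∀ x : Sph n,
      min (axial (r • (P k : Amb n)) s x) (axial (r • (P l : Amb n)) s x) ≤ C)
    (hc : ∀ k, ∫ x : Sph n, axial (r • (P k : Amb n)) s x ∂(vol n) = c) :
    ∫ x : Sph n, |∑ k, σ k * bubble s r (P k) x ^ ((s + 2) / s)| ^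
        (((s + 2) / s + 1) / ((s + 2) / s)) ∂(vol n) ≤
      Fintype.card ι * (vol n).real Set.univ + (Fintype.card ι + 2) * Fintype.card ι ^ 2 *
        C ^ ((s + 2) / s) * (1 - r ^ 2) * (((1 - r ^ 2) ^ (s / 2)) ^ 2 * c) := by
  have h3 : (3 : ℝ) ≤ n := by exact_mod_cast hn
  have hs0 : 0 < s := by linarith
  have hr : |r| < 1 := abs_lt.2 ⟨by linarith, hr1⟩
  have he := one_sub_sq_pos hr
  set δ := (1 - r ^ 2) ^ (s / 2) with hδ
  have hδ0 : 0 < δ := Real.rpow_pos_of_pos he _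
  set q := (s + 2) / s with hq
  have hq1 : 1 ≤ q := by rw [hq, le_div_iff₀ hs0]; linarith
  have hδq : δ ^ q = δ * (1 - r ^ 2) := by
    rw [hδ, ← Real.rpow_mul he.le, ← Real.rpow_add_one he.ne', hq]; congr 1; field_simp
  have hpt : ∀ x : Sph n, |∑ k, σ k * bubble s r (P k) x ^ q| ^ ((q + 1) / q) ≤
      ∑ k, bubble s r (P k) x ^ (q + 1) +
      (Fintype.card ι + 2) * (Fintype.card ι * (δ * C) ^ q) * ∑ k, bubble s r (P k) x := fun x => by
    refine le_trans (Real.rpow_le_rpow (abs_nonneg _) ?_ (by positivity))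
      (rpow_sum_rpow_le (fun k => bubble s r (P k) x) (fun k => bubble_pos hr (P k) x) hq1
        (mul_nonneg hδ0.le hC0) fun k l hkl => ?_)
    · refine (Finset.abs_sum_le_sum_abs _ _).trans (Finset.sum_le_sum fun k _ => ?_)
      have h1 : |σ k| = 1 := by
        rw [← sq_eq_sq₀ (abs_nonneg _) zero_le_one, sq_abs, hσ]; norm_num
      rw [abs_mul, h1, one_mul, abs_of_pos (Real.rpow_pos_of_pos (bubble_pos hr (P k) x) _)]
    · simp only [bubble]
      rw [← mul_min_of_nonneg _ _ hδ0.le]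
      exact mul_le_mul_of_nonneg_left (hC k l hkl x) hδ0.le
  have i1 : ∀ k, Integrable (fun x : Sph n => bubble s r (P k) x ^ (q + 1)) (vol n) := fun k =>
    integrable_of_continuous (continuous_bubble_rpow hr (P k) _)
  have i2 : ∀ k, Integrable (fun x : Sph n => bubble s r (P k) x) (vol n) := fun k =>
    integrable_of_continuous (continuous_bubble hr (P k))
  have i3 : Integrable (fun x : Sph n => ∑ k, bubble s r (P k) x ^ (q + 1)) (vol n) :=
    integrable_finsetSum _ fun k _ => i1 k
  have i4 : Integrable (fun x : Sph n => ∑ k, bubble s r (P k) x) (vol n) :=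
    integrable_finsetSum _ fun k _ => i2 k
  have i5 : Integrable (fun x : Sph n =>
      |∑ k, σ k * bubble s r (P k) x ^ q| ^ ((q + 1) / q)) (vol n) := by
    refine integrable_of_continuous (Continuous.rpow_const ?_ fun x => Or.inr (by positivity))
    exact (continuous_finsetSum _ fun k _ =>
      continuous_const.mul (continuous_bubble_rpow hr (P k) q)).abs
  refine (integral_mono i5 (i3.add (i4.const_mul _)) hpt).trans_eq ?_
  have hbub : ∀ k, ∫ x : Sph n, bubble s r (P k) x ∂(vol n) = δ * c := fun k => by
    rw [← hc k, ← integral_const_mul]; rfl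
  simp only [Pi.add_apply]
  rw [integral_add i3 (i4.const_mul _), integral_const_mul, integral_finsetSum _ fun k _ => i1 k,
    integral_finsetSum _ fun k _ => i2 k,
    Finset.sum_congr rfl fun k _ => integral_bubble_critical hn hs hr (P k),
    Finset.sum_congr rfl fun k _ => hbub k, Finset.sum_const, Finset.sum_const, Finset.card_univ,
    nsmul_eq_mul, nsmul_eq_mul, Real.mul_rpow hδ0.le hC0, hδq]
  ring

lemma exists_uniform_min_axial_le (hs : 0 ≤ s) (P : ι → Sph n) (hP : Function.Injective P) :
    ∃ C : ℝ, 0 ≤ C ∧ ∀ k l, k ≠ l → ∀ r : ℝ, 0 ≤ r → r ≤ 1 → ∀ x : Sph n,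
      min (axial (r • (P k : Amb n)) s x) (axial (r • (P l : Amb n)) s x) ≤ C := by
  have h : ∀ z : ι × ι, ∃ C : ℝ, z.1 ≠ z.2 → ∀ r : ℝ, 0 ≤ r → r ≤ 1 → ∀ x : Sph n,
      min (axial (r • (P z.1 : Amb n)) s x) (axial (r • (P z.2 : Amb n)) s x) ≤ C := fun z => by
    by_cases hz : z.1 = z.2
    · exact ⟨0, fun h => (h hz).elim⟩
    · obtain ⟨C, hC⟩ := exists_min_axial_le (hP.ne hz) hs
      exact ⟨C, fun _ => hC⟩
  choose C hC using h
  obtain ⟨M, hM⟩ := (Set.finite_range C).bddAbove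
  exact ⟨max M 0, le_max_right _ _, fun k l hkl r hr0 hr1 x =>
    (hC (k, l) hkl r hr0 hr1 x).trans ((hM ⟨(k, l), rfl⟩).trans (le_max_left _ _))⟩

lemma integral_dual_pairing_ge [DecidableEq ι] (hn : 3 ≤ n) (hs : 2 * s = n - 2) (P : ι → Sph n)
    (σ : ι → ℝ) (hσ : ∀ k, σ k ^ 2 = 1) {r c η : ℝ} (hr : |r| < 1) (hηc : 0 ≤ η * c)
    (h : ∀ k l, k ≠ l → |(1 - r ^ 2) * ∫ x : Sph n, axial (r • (P k : Amb n)) (s + 2) x *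
      axial (r • (P l : Amb n)) s x ∂(vol n) - c * (1 - ⟪(P k : Amb n), (P l : Amb n)⟫) ^ (-s)| ≤
        η * c) :
    Fintype.card ι * (vol n).real Set.univ + ((1 - r ^ 2) ^ (s / 2)) ^ 2 *
      (c * (∑ k, ∑ l, if k ≠ l then
        σ k * σ l * (1 - ⟪(P k : Amb n), (P l : Amb n)⟫) ^ (-s) else 0) -
        Fintype.card ι ^ 2 * (η * c)) ≤
      ∫ x : Sph n, (∑ k, σ k * bubble s r (P k) x) *
        (∑ k, σ k * bubble s r (P k) x ^ ((s + 2) / s)) ∂(vol n) := by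
  have h3 : (3 : ℝ) ≤ n := by exact_mod_cast hn
  have hs0 : 0 < s := by linarith
  have hdiag : ∀ k, ∫ x : Sph n, bubble s r (P k) x ^ ((s + 2) / s) * bubble s r (P k) x ∂(vol n) =
      (vol n).real Set.univ := fun k => by
    rw [← integral_bubble_critical hn hs hr (P k)]
    refine integral_congr_ae (Eventually.of_forall fun x => ?_)
    simp only
    rw [Real.rpow_add_one (bubble_pos hr (P k) x).ne']
  rw [integral_dual_pairing P σ hr, sum_sum_eq_card_add σ hσ (fun k l =>
    ∫ x : Sph n, bubble s r (P k) x ^ ((s + 2) / s) * bubble s r (P l) x ∂(vol n)) _ hdiag]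
  refine add_le_add_right ?_ _
  refine (mul_le_mul_of_nonneg_left (sum_interaction_ge σ hσ (fun k l => (1 - r ^ 2) *
    ∫ x : Sph n, axial (r • (P k : Amb n)) (s + 2) x * axial (r • (P l : Amb n)) s x ∂(vol n))
    (fun k l => (1 - ⟪(P k : Amb n), (P l : Amb n)⟫) ^ (-s)) hηc h) (sq_nonneg _)).trans_eq ?_
  simp only [Finset.mul_sum, integral_bubble_interaction hs0 hr]
  refine Finset.sum_congr rfl fun k _ => Finset.sum_congr rfl fun l _ => ?_
  split_ifs
  · ring
  · ring

/-- For concentrated bubbles with positive total interaction the dual Sobolev quotient of their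
signed sum lies below that of separate bubbles. -/
lemma exists_dual_quotient_lt [DecidableEq ι] (hn : 3 ≤ n) (hs : 2 * s = n - 2) (P : ι → Sph n)
    (hP : Function.Injective P) (σ : ι → ℝ) (hσ : ∀ k, σ k ^ 2 = 1)
    (hK : 0 < ∑ k, ∑ l, if k ≠ l then
      σ k * σ l * (1 - ⟪(P k : Amb n), (P l : Amb n)⟫) ^ (-s) else 0) :
    ∃ r : ℝ, |r| < 1 ∧
      0 < ∫ x : Sph n, (∑ k, σ k * bubble s r (P k) x) *
        (∑ k, σ k * bubble s r (P k) x ^ ((s + 2) / s)) ∂(vol n) ∧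
      (∫ x : Sph n, |∑ k, σ k * bubble s r (P k) x ^ ((s + 2) / s)| ^
        (((s + 2) / s + 1) / ((s + 2) / s)) ∂(vol n)) ^ (((n : ℝ) + 2) / 2) <
      Fintype.card ι * (vol n).real Set.univ *
        (∫ x : Sph n, (∑ k, σ k * bubble s r (P k) x) *
          (∑ k, σ k * bubble s r (P k) x ^ ((s + 2) / s)) ∂(vol n)) ^ ((n : ℝ) / 2) := by
  have h3 : (3 : ℝ) ≤ n := by exact_mod_cast hn
  have hs0 : 0 < s := by linarith
  set K := ∑ k, ∑ l, if k ≠ l then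
      σ k * σ l * (1 - ⟪(P k : Amb n), (P l : Amb n)⟫) ^ (-s) else 0 with hKdef
  have hne : Nonempty ι := by
    by_contra h
    rw [not_nonempty_iff] at h
    simp [hKdef] at hK
  obtain ⟨k₀⟩ := hne
  set N : ℝ := (Fintype.card ι : ℝ) with hN
  have hN1 : 1 ≤ N := Nat.one_le_cast.2 (Fintype.card_pos_iff.2 ⟨k₀⟩)
  have hN0 : 0 < N := by linarith
  have hV := vol_pos n
  set V := (vol n).real Set.univ with hVdef
  obtain ⟨C, hC0, hC⟩ := exists_uniform_min_axial_le hs0.le P hP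
  -- Errors of size `η c` over at most `N²` pairs then cost half of the total interaction `K c`.
  set η := K / (2 * N ^ 2) with hη
  have hη0 : 0 < η := by positivity
  have ev1 : ∀ᶠ r : ℝ in 𝓝[<] 1, ∀ k l, k ≠ l →
      |(1 - r ^ 2) * ∫ x : Sph n, axial (r • (P k : Amb n)) (s + 2) x *
          axial (r • (P l : Amb n)) s x ∂(vol n) -
        (∫ x : Sph n, axial (r • (P k : Amb n)) s x ∂(vol n)) *
          (1 - ⟪(P k : Amb n), (P l : Amb n)⟫) ^ (-s)| ≤
      η * ∫ x : Sph n, axial (r • (P k : Amb n)) s x ∂(vol n) := by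
    refine eventually_all.2 fun k => eventually_all.2 fun l => ?_
    by_cases hkl : k = l
    · exact Eventually.of_forall fun r h => (h hkl).elim
    · filter_upwards [eventually_interaction hn hs (hP.ne hkl) hη0] with r hr _ using hr
  -- With gain `Y = (K/2) δ² c`, the bound `K / 8` makes the excess of the dual norm at most `Y /
  -- 4`.
  have ev2 : ∀ᶠ r : ℝ in 𝓝[<] 1,
      (N + 2) * N ^ 2 * C ^ ((s + 2) / s) * (1 - r ^ 2) < K / 8 := by
    have hc : Continuous fun r : ℝ => (N + 2) * N ^ 2 * C ^ ((s + 2) / s) * (1 - r ^ 2) := by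
      fun_prop
    have := hc.tendsto 1
    simp only [one_pow, sub_self, mul_zero] at this
    exact (this.mono_left nhdsWithin_le_nhds).eventually (gt_mem_nhds (by positivity))
  -- Combined with `δ c ≤ 2V`, this yields the smallness condition `(n + 2) Y ≤ 8 S` for `S = NV`.
  have ev3 : ∀ᶠ r : ℝ in 𝓝[<] 1,
      ((n : ℝ) + 2) * (K / 2 * (2 * V)) * (1 - r ^ 2) ^ (s / 2) < 8 * (N * V) := by
    have hc : Continuous fun r : ℝ =>
        ((n : ℝ) + 2) * (K / 2 * (2 * V)) * (1 - r ^ 2) ^ (s / 2) :=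
      continuous_const.mul (Continuous.rpow_const (by fun_prop) fun _ => Or.inr (by positivity))
    have := hc.tendsto 1
    rw [one_pow, sub_self, Real.zero_rpow (by positivity), mul_zero] at this
    exact (this.mono_left nhdsWithin_le_nhds).eventually (gt_mem_nhds (by positivity))
  obtain ⟨r, h1, h2, h3', hr⟩ := (ev1.and (ev2.and (ev3.and
    (Ioo_mem_nhdsLT (zero_lt_one (α := ℝ)))))).exists
  have hra : |r| < 1 := abs_lt.2 ⟨by linarith [hr.1], hr.2⟩
  have he := one_sub_sq_pos hra
  set c := ∫ x : Sph n, axial (r • (P k₀ : Amb n)) s x ∂(vol n) with hcdef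
  have hck : ∀ k, ∫ x : Sph n, axial (r • (P k : Amb n)) s x ∂(vol n) = c := fun k =>
    integral_axial_eq r s (P k) (P k₀)
  have hc0 : 0 < c := lt_of_lt_of_le (mul_pos (by positivity) hV)
    (vol_le_integral_axial hs0.le (P k₀) hr.1.le hr.2)
  set δ := (1 - r ^ 2) ^ (s / 2) with hδ
  have hδ0 : 0 < δ := Real.rpow_pos_of_pos he _
  have hδc : δ * c ≤ 2 * V := by
    have := integral_bubble_le hn hs hra (P k₀)
    simp only [bubble, integral_const_mul] at this
    exact this
  have hWle := integral_dual_norm_le hn hs P σ hσ hr.1.le hr.2 hC0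
    (fun k l hkl x => hC k l hkl r hr.1.le hr.2.le x) hck
  simp only [hck] at h1
  have hEge := integral_dual_pairing_ge hn hs P σ hσ hra (by positivity) h1
  have hNη : N ^ 2 * (η * c) = K / 2 * c := by rw [hη]; field_simp
  rw [← hKdef, ← hN, hNη, ← hVdef, ← hδ, show δ ^ 2 * (c * K - K / 2 * c) = K / 2 * (δ ^ 2 * c) by
    ring] at hEge
  rw [← hN, ← hVdef, ← hδ] at hWle
  clear_value K N V c δ η
  have hY : 0 < K / 2 * (δ ^ 2 * c) := by positivity
  refine ⟨r, hra, lt_of_lt_of_le (by positivity) hEge, ?_⟩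
  refine rpow_lt_mul_rpow_of_gap h3 (mul_pos hN0 hV) hY hEge
    (integral_nonneg fun x => Real.rpow_nonneg (abs_nonneg _) _) (hWle.trans ?_) ?_
  · refine add_le_add_right ?_ _
    have := mul_le_mul_of_nonneg_right h2.le (by positivity : 0 ≤ δ ^ 2 * c)
    linarith
  · have := mul_le_mul_of_nonneg_left hδc (by positivity : 0 ≤ ((n : ℝ) + 2) * (K / 2) * δ)
    have e : ((n : ℝ) + 2) * (K / 2 * (δ ^ 2 * c)) = ((n : ℝ) + 2) * (K / 2) * δ * (δ * c) := by
      ring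
    rw [e]
    linarith

end BubbleSum

/-! ### Sobolev membership and energy of the test function -/

lemma memLp_of_continuous {E : Type*} [NormedAddCommGroup E] {f : Sph n → E}
    (hf : Continuous f) (p : ENNReal) : MemLp f p (vol n) :=
  hf.memLp_of_hasCompactSupport (HasCompactSupport.of_compactSpace f)

lemma memH1_of_contMDiff {u : Sph n → ℝ} {G : Sph n → Amb n}
    (hu : ContMDiff (𝓡 n) 𝓘(ℝ, ℝ) ∞ u) (hG : IsGradient u G) (hGc : Continuous G) :
    MemH1 u G :=
  ⟨memLp_of_continuous hu.continuous 2, memLp_of_continuous hGc 2, fun _ => u, fun _ => G,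
    fun _ => hu, fun _ => hG, by simp, by simp⟩

section AxialSum

variable {ι : Type*} [Fintype ι] {s : ℝ} {b : ι → Amb n} (τ : ι → ℝ)

lemma isGradient_axialSum (hb : ∀ k, ‖b k‖ < 1) :
    IsGradient (fun x : Sph n => ∑ k, τ k * axial (b k) s x)
      fun x => ∑ k, τ k • axialGrad (b k) s x := by
  have := isGradient_restrict (fun x => ∑ k, τ k * axial (b k) s x)
    (fun x => ∑ k, τ k • ((s * axial (b k) (s + 1) x) • b k)) fun x => by
      rw [map_sum]
      refine HasFDerivAt.fun_sum fun k _ => ?_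
      rw [map_smul]
      exact (hasFDerivAt_axial (hb k) s x).const_mul (τ k)
  convert this using 2 with x
  rw [inner_sum, Finset.sum_smul, ← Finset.sum_sub_distrib]
  refine Finset.sum_congr rfl fun k _ => ?_
  rw [axialGrad, real_inner_smul_right, real_inner_smul_right, real_inner_comm, smul_sub, smul_sub,
    smul_smul, smul_smul, smul_smul, mul_assoc]

lemma contMDiff_axialSum (hb : ∀ k, ‖b k‖ < 1) :
    ContMDiff (𝓡 n) 𝓘(ℝ, ℝ) ∞ (fun x : Sph n => ∑ k, τ k * axial (b k) s x) := fun x => by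
  have h : ContDiffAt ℝ ∞ (fun x => ∑ k, τ k * axial (b k) s x) (x : Amb n) :=
    ContDiffAt.sum fun k _ => contDiffAt_const.mul (contDiffAt_axial (hb k) s x)
  exact h.contMDiffAt.comp x (contMDiff_coe_sph x)

lemma memH1_axialSum (hb : ∀ k, ‖b k‖ < 1) :
    MemH1 (fun x : Sph n => ∑ k, τ k * axial (b k) s x)
      fun x => ∑ k, τ k • axialGrad (b k) s x :=
  memH1_of_contMDiff (contMDiff_axialSum τ hb) (isGradient_axialSum τ hb)
    (continuous_finsetSum _ fun k _ => (continuous_axialGrad (hb k) s).const_smul (τ k))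

lemma energyNormSq_axialSum (hs : 2 * s = n - 2) (hb : ∀ k, ‖b k‖ < 1) :
    energyNormSq (fun x : Sph n => ∑ k, τ k * axial (b k) s x)
      (fun x => ∑ k, τ k • axialGrad (b k) s x) =
    coeffA n * ∫ x : Sph n, (∑ k, τ k * axial (b k) s x) *
      (∑ k, τ k * ((1 - ‖b k‖ ^ 2) * axial (b k) (s + 2) x)) ∂(vol n) := by
  have i1 : ∀ k l, Integrable (fun x : Sph n => ⟪axialGrad (b k) s x, axialGrad (b l) s x⟫ +
      coeffA n * (axial (b k) s x * axial (b l) s x)) (vol n) := fun k l => by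
    refine integrable_of_continuous ?_
    exact ((continuous_axialGrad (hb k) s).inner (continuous_axialGrad (hb l) s)).add
      (continuous_const.mul ((continuous_axial (hb k) s).mul (continuous_axial (hb l) s)))
  have i2 : ∀ k l, Integrable (fun x : Sph n => axial (b k) (s + 2) x * axial (b l) s x) (vol n) :=
    fun k l => integrable_of_continuous
      ((continuous_axial (hb k) (s + 2)).mul (continuous_axial (hb l) s))
  have e1 : energyNormSq (fun x : Sph n => ∑ k, τ k * axial (b k) s x)
      (fun x => ∑ k, τ k • axialGrad (b k) s x) = ∑ k, ∑ l, τ k * τ l *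
      ∫ x : Sph n, (⟪axialGrad (b k) s x, axialGrad (b l) s x⟫ +
        coeffA n * (axial (b k) s x * axial (b l) s x)) ∂(vol n) := by
    simp only [← integral_const_mul]
    rw [Finset.sum_congr rfl fun k _ => (integral_finsetSum Finset.univ
      fun l _ => (i1 k l).const_mul (τ k * τ l)).symm, ← integral_finsetSum Finset.univ
      fun k _ => integrable_finsetSum _ fun l _ => (i1 k l).const_mul (τ k * τ l)]
    refine integral_congr_ae (Eventually.of_forall fun x => ?_)
    simp only
    rw [← real_inner_self_eq_norm_sq, sum_inner, sq, Finset.sum_mul_sum, Finset.mul_sum,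
      ← Finset.sum_add_distrib]
    refine Finset.sum_congr rfl fun k _ => ?_
    rw [inner_sum, Finset.mul_sum, ← Finset.sum_add_distrib]
    refine Finset.sum_congr rfl fun l _ => ?_
    rw [real_inner_smul_left, real_inner_smul_right]; ring
  have e2 : ∫ x : Sph n, (∑ k, τ k * axial (b k) s x) *
      (∑ k, τ k * ((1 - ‖b k‖ ^ 2) * axial (b k) (s + 2) x)) ∂(vol n) = ∑ k, ∑ l, τ k * τ l *
      ((1 - ‖b k‖ ^ 2) * ∫ x : Sph n, axial (b k) (s + 2) x * axial (b l) s x ∂(vol n)) := by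
    simp only [← integral_const_mul]
    rw [Finset.sum_congr rfl fun k _ => (integral_finsetSum Finset.univ
      fun l _ => ((i2 k l).const_mul _).const_mul (τ k * τ l)).symm,
      ← integral_finsetSum Finset.univ
      fun k _ => integrable_finsetSum _ fun l _ => ((i2 k l).const_mul _).const_mul (τ k * τ l)]
    refine integral_congr_ae (Eventually.of_forall fun x => ?_)
    simp only
    rw [Finset.sum_mul_sum, Finset.sum_comm]
    refine Finset.sum_congr rfl fun k _ => Finset.sum_congr rfl fun l _ => ?_
    ring
  rw [e1, e2, Finset.mul_sum]
  refine Finset.sum_congr rfl fun k _ => ?_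
  rw [Finset.mul_sum]
  refine Finset.sum_congr rfl fun l _ => ?_
  rw [integral_green hs (hb k) (hb l)]; ring

end AxialSum

/-! ### Nehari scaling and duality -/

lemma energyNormSq_smul (T : ℝ) (u : Sph n → ℝ) (G : Sph n → Amb n) :
    energyNormSq (fun x => T * u x) (fun x => T • G x) = T ^ 2 * energyNormSq u G := by
  unfold energyNormSq
  rw [← integral_const_mul]
  refine integral_congr_ae (Eventually.of_forall fun x => ?_)
  simp only [norm_smul, mul_pow, Real.norm_eq_abs, sq_abs]; ring

lemma critNormPow_smul {T : ℝ} (hT : 0 ≤ T) (u : Sph n → ℝ) :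
    critNormPow (fun x => T * u x) = T ^ critExp n * critNormPow u := by
  unfold critNormPow
  rw [← integral_const_mul]
  refine integral_congr_ae (Eventually.of_forall fun x => ?_)
  simp only [abs_mul, abs_of_nonneg hT, Real.mul_rpow hT (abs_nonneg _)]; ring

/-- A pair `(u, G)` can be scaled into the Nehari manifold; this gives a bound on the infimum by
the Sobolev quotient of `u`. -/
lemma cEquiv_le_of_scaling (hn : 3 ≤ n) {s : ℝ} (hs : 2 * s = n - 2)
    {Γ : Subgroup (OrthGroup n)} (φ : Γ →* ℤˣ)
    (u : Sph n → ℝ) (G : Sph n → Amb n)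
    (hu : ∀ T : ℝ, MemH1 (fun x => T * u x) (fun x => T • G x)) (hφ : IsEquivariant φ u)
    (hE : 0 < energyNormSq u G) (hB : 0 < critNormPow u) :
    cEquiv φ ≤ ((1 / n * (energyNormSq u G * (energyNormSq u G / critNormPow u) ^ s) : ℝ) :
      EReal) := by
  have h3 : (3 : ℝ) ≤ n := by exact_mod_cast hn
  have hs0 : 0 < s := by linarith
  have hn2 : (n : ℝ) = 2 * s + 2 := by linarith
  have hcrit : critExp n = 2 + 2 / s := by
    rw [critExp, hn2, show 2 * s + 2 - 2 = 2 * s by ring]; field_simp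
  set E := energyNormSq u G
  set B := critNormPow u
  have hEB : 0 < E / B := div_pos hE hB
  -- Solves `T² E = T^(2*) B`, because `2* - 2 = 2 / s`.
  set T := (E / B) ^ (s / 2) with hT
  have hT0 : 0 < T := Real.rpow_pos_of_pos hEB _
  have hT2 : T ^ 2 = (E / B) ^ s := by
    rw [hT, ← Real.rpow_natCast, ← Real.rpow_mul hEB.le]; congr 1; push_cast; ring
  have hTc : T ^ critExp n = T ^ 2 * (E / B) := by
    rw [hcrit, Real.rpow_add hT0, Real.rpow_ofNat, hT, ← Real.rpow_mul hEB.le (s / 2) (2 / s),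
      show s / 2 * (2 / s) = 1 by field_simp, Real.rpow_one]
  have hnorm : energyNormSq (fun x => T * u x) (fun x => T • G x) =
      critNormPow (fun x => T * u x) := by
    rw [energyNormSq_smul, critNormPow_smul hT0.le, hTc, mul_assoc]
    congr 1
    exact (div_mul_cancel₀ E hB.ne').symm
  refine iInf₂_le_of_le ((fun x => T * u x), (fun x => T • G x)) ⟨hu T, ?_, ?_, hnorm⟩ ?_
  · intro γ
    filter_upwards [hφ γ] with x hx
    simp only [hx]; ring
  · intro h0
    have h1 : critNormPow (fun x => T * u x) = 0 := by
      have : (fun x => coeffA n * |T * u x| ^ critExp n) =ᵐ[vol n] 0 := by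
        filter_upwards [h0] with x hx
        simp only [Pi.zero_apply] at hx ⊢
        rw [hx, abs_zero, Real.zero_rpow (by rw [hcrit]; positivity), mul_zero]
      unfold critNormPow
      rw [integral_congr_ae this]; simp
    rw [← hnorm, energyNormSq_smul] at h1
    exact (mul_pos (pow_pos hT0 2) hE).ne' h1
  -- On the Nehari manifold the functional is `(1/2 - 1/2*) ‖u‖² = ‖u‖² / n`.
  · rw [EReal.coe_le_coe_iff, functionalJ, ← hnorm, energyNormSq_smul, hT2, hcrit, hn2]
    refine le_of_eq ?_
    change 1 / 2 * ((E / B) ^ s * E) - 1 / (2 + 2 / s) * ((E / B) ^ s * E) = _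
    field_simp
    ring

/-- The Sobolev quotient is controlled by the dual one. -/
lemma quotient_lt_of_dual {s ν E B W S : ℝ} (hs : 0 < s) (hν : ν = 2 * s + 2) (hE : 0 < E)
    (hB : 0 ≤ B) (hW : 0 ≤ W)
    (hEBW : E ≤ B ^ (1 / ((s + 2) / s + 1)) * W ^ (1 / (((s + 2) / s + 1) / ((s + 2) / s))))
    (h : W ^ ((ν + 2) / 2) < S * E ^ (ν / 2)) :
    0 < B ∧ E * (E / B) ^ s < S := by
  have hB0 : 0 < B := by
    refine lt_of_le_of_ne hB fun h0 => ?_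
    rw [← h0, Real.zero_rpow (by positivity), zero_mul] at hEBW
    linarith
  refine ⟨hB0, ?_⟩
  -- The `ν`-th power of Hölder's inequality: `ν / (q + 1) = s` and `ν q / (q + 1) = s + 2 = (ν + 2)
  -- / 2`.
  have h1 : E ^ ν ≤ B ^ s * W ^ ((ν + 2) / 2) := by
    refine (Real.rpow_le_rpow hE.le hEBW (by rw [hν]; positivity)).trans_eq ?_
    rw [Real.mul_rpow (Real.rpow_nonneg hB _) (Real.rpow_nonneg hW _), ← Real.rpow_mul hB,
      ← Real.rpow_mul hW, hν]
    congr 2 <;> field_simp <;> ring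
  have hBs : 0 < B ^ s := Real.rpow_pos_of_pos hB0 _
  have hEν : 0 < E ^ (ν / 2) := Real.rpow_pos_of_pos hE _
  have h2 : E ^ (ν / 2) * E ^ (ν / 2) < B ^ s * S * E ^ (ν / 2) := by
    rw [← Real.rpow_add hE, add_halves, mul_assoc]
    exact h1.trans_lt (mul_lt_mul_of_pos_left h hBs)
  have h3 := lt_of_mul_lt_mul_right h2 hEν.le
  have h4 : E * (E / B) ^ s = E ^ (ν / 2) / B ^ s := by
    rw [Real.div_rpow hE.le hB, hν, show (2 * s + 2) / 2 = 1 + s by ring, Real.rpow_add hE,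
      Real.rpow_one]
    ring
  rw [h4, div_lt_iff₀ hBs, mul_comm]
  exact h3

/-- The infimum over equivariant functions is below the energy of separate bubbles as soon as
the signed bubbles form an equivariant function with positive total interaction. -/
lemma cEquiv_lt_of_interaction_pos {ι : Type*} [Fintype ι] [DecidableEq ι] (hn : 3 ≤ n) {s : ℝ}
    (hs : 2 * s = n - 2) {Γ : Subgroup (OrthGroup n)} (φ : Γ →* ℤˣ) (P : ι → Sph n)
    (hP : Function.Injective P) (σ : ι → ℝ) (hσ : ∀ k, σ k ^ 2 = 1)
    (hφ : ∀ r, IsEquivariant φ (fun x : Sph n => ∑ k, σ k * bubble s r (P k) x))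
    (hK : 0 < ∑ k, ∑ l, if k ≠ l then
      σ k * σ l * (1 - ⟪(P k : Amb n), (P l : Amb n)⟫) ^ (-s) else 0) :
    cEquiv φ < ((Fintype.card ι * cConst n : ℝ) : EReal) := by
  have h3 : (3 : ℝ) ≤ n := by exact_mod_cast hn
  have hs0 : 0 < s := by linarith
  have hn2 : (n : ℝ) = 2 * s + 2 := by linarith
  obtain ⟨r, hr, hE, hlt⟩ := exists_dual_quotient_lt hn hs P hP σ hσ hK
  have hb : ∀ k, ‖r • (P k : Amb n)‖ < 1 := fun k => norm_smul_sph_lt hr (P k)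
  set q := (s + 2) / s with hq
  have hq0 : 0 < q := by positivity
  have hcrit : critExp n = q + 1 := by
    rw [critExp, hn2, hq, show 2 * s + 2 - 2 = 2 * s by ring]; field_simp; ring
  have ha : 0 < coeffA n := by
    unfold coeffA
    have : 0 < (n : ℝ) * (n - 2) := mul_pos (by linarith) (by linarith)
    linarith
  set u : Sph n → ℝ := fun x => ∑ k, σ k * bubble s r (P k) x with hu
  set w : Sph n → ℝ := fun x => ∑ k, σ k * bubble s r (P k) x ^ q with hw
  set δ := (1 - r ^ 2) ^ (s / 2) with hδ
  set G : Sph n → Amb n := fun x => ∑ k, (σ k * δ) • axialGrad (r • (P k : Amb n)) s x with hG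
  have huc : Continuous u :=
    continuous_finsetSum _ fun k _ => continuous_const.mul (continuous_bubble hr (P k))
  have hwc : Continuous w :=
    continuous_finsetSum _ fun k _ => continuous_const.mul (continuous_bubble_rpow hr (P k) q)
  have hu' : ∀ x, u x = ∑ k, (σ k * δ) * axial (r • (P k : Amb n)) s x := fun x =>
    Finset.sum_congr rfl fun k _ => by rw [bubble, mul_assoc]
  have hmem : ∀ T : ℝ, MemH1 (fun x => T * u x) (fun x => T • G x) := fun T => by
    have := memH1_axialSum (s := s) (fun k => T * (σ k * δ)) hb
    convert this using 2 with x x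
    · rw [hu', Finset.mul_sum]
      exact Finset.sum_congr rfl fun k _ => by ring
    · rw [hG, Finset.smul_sum]
      exact Finset.sum_congr rfl fun k _ => by rw [smul_smul]
  have henergy : energyNormSq u G = coeffA n * ∫ x, u x * w x ∂(vol n) := by
    have := energyNormSq_axialSum (fun k => σ k * δ) hs hb
    rw [← funext hu'] at this
    rw [this]
    congr 1
    refine integral_congr_ae (Eventually.of_forall fun x => ?_)
    simp only [hw, hu']
    congr 1
    refine Finset.sum_congr rfl fun k _ => ?_
    rw [hq, bubble_rpow_dual hs0 hr, norm_smul, norm_sph, mul_one, Real.norm_eq_abs, sq_abs]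
    ring
  set E₀ := ∫ x, u x * w x ∂(vol n) with hE₀
  set B₀ := ∫ x, |u x| ^ (q + 1) ∂(vol n) with hB₀
  set W₀ := ∫ x, |w x| ^ ((q + 1) / q) ∂(vol n) with hW₀
  have hcritnorm : critNormPow u = coeffA n * B₀ := by
    rw [critNormPow, integral_const_mul, hcrit]
  have hconj : (q + 1).HolderConjugate ((q + 1) / q) :=
    Real.holderConjugate_iff.2 ⟨by linarith, by field_simp; ring⟩
  have hholder : E₀ ≤ B₀ ^ (1 / (q + 1)) * W₀ ^ (1 / ((q + 1) / q)) := by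
    have h1 : E₀ ≤ ∫ x, ‖u x‖ * ‖w x‖ ∂(vol n) := by
      refine integral_mono (integrable_of_continuous (huc.mul hwc))
        (integrable_of_continuous (huc.norm.mul hwc.norm)) fun x => ?_
      simp only [← norm_mul]
      exact Real.le_norm_self _
    exact h1.trans (integral_mul_norm_le_Lp_mul_Lq hconj (memLp_of_continuous huc _)
      (memLp_of_continuous hwc _))
  have hB0 : 0 ≤ B₀ := integral_nonneg fun x => Real.rpow_nonneg (abs_nonneg _) _
  have hW0 : 0 ≤ W₀ := integral_nonneg fun x => Real.rpow_nonneg (abs_nonneg _) _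
  obtain ⟨hBpos, hquot⟩ := quotient_lt_of_dual hs0 hn2 hE hB0 hW0 hholder hlt
  refine (cEquiv_le_of_scaling hn hs φ u G hmem (hφ r) ?_ ?_).trans_lt ?_
  · rw [henergy]; exact mul_pos ha hE
  · rw [hcritnorm]; exact mul_pos ha hBpos
  · rw [EReal.coe_lt_coe_iff, henergy, hcritnorm, mul_div_mul_left _ _ ha.ne']
    have hn0 : (0 : ℝ) < n := by linarith
    calc 1 / (n : ℝ) * (coeffA n * E₀ * (E₀ / B₀) ^ s)
        = 1 / (n : ℝ) * coeffA n * (E₀ * (E₀ / B₀) ^ s) := by ring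
      _ < 1 / (n : ℝ) * coeffA n * (Fintype.card ι * (vol n).real Set.univ) :=
        mul_lt_mul_of_pos_left hquot (by positivity)
      _ = _ := by rw [coeffA, cConst]; field_simp

/-! ### The orbit sum and its interaction -/

lemma one_sub_cos_geoDist (p q : Sph n) :
    1 - Real.cos (geoDist p q) = 1 - ⟪(p : Amb n), (q : Amb n)⟫ := by
  have := abs_le.1 (abs_inner_sph_le (p : Amb n) q)
  rw [norm_sph] at this
  rw [geoDist, Real.cos_arccos this.1 this.2]

lemma inner_act_act (γ : OrthGroup n) (p q : Sph n) :
    ⟪(act γ p : Amb n), (act γ q : Amb n)⟫ = ⟪(p : Amb n), (q : Amb n)⟫ :=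
  γ.inner_map_map _ _

lemma bubble_act_act (s r : ℝ) (γ : OrthGroup n) (p x : Sph n) :
    bubble s r (act γ p) (act γ x) = bubble s r p x := by
  rw [bubble, bubble, axial, axial, real_inner_smul_left, real_inner_smul_left, inner_act_act]

/-- Reindex the sum by left multiplication by `γ`: bubbles are carried to bubbles, and `φ (γ k) = φ
γ φ k` pulls out the sign. -/
lemma isEquivariant_bubbleSum {Γ : Subgroup (OrthGroup n)} [Fintype Γ] (φ : Γ →* ℤˣ) (p : Sph n)
    (s r : ℝ) : IsEquivariant φ fun x : Sph n =>
      ∑ k : Γ, (((φ k : ℤˣ) : ℤ) : ℝ) * bubble s r (act (k : OrthGroup n) p) x := by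
  refine fun γ => Eventually.of_forall fun x => ?_
  simp only
  rw [← Equiv.sum_comp (Equiv.mulLeft γ), Finset.mul_sum]
  refine Finset.sum_congr rfl fun k _ => ?_
  rw [Equiv.coe_mulLeft, Subgroup.coe_mul, act_mul, bubble_act_act, map_mul]
  push_cast
  ring

/-- A point fixed by all the `g i` has no mutual interaction. -/
lemma muSame_eq_zero_of_fixed {m : ℕ} (hn : 3 ≤ n) (g : Fin m → OrthGroup n) (p : Sph n)
    (h : ∀ i, act (g i) p = p) : muSame g p = 0 := by
  have h3 : (3 : ℝ) ≤ n := by exact_mod_cast hn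
  unfold muSame
  refine Finset.sum_eq_zero fun i _ => Finset.sum_eq_zero fun j _ => ?_
  rw [h, h, one_sub_cos_geoDist, inner_sph_self, sub_self, Real.zero_rpow (by linarith), ite_self]

lemma muOpp_nonneg {m : ℕ} (g : Fin m → OrthGroup n) (γ : OrthGroup n) (p : Sph n) :
    0 ≤ muOpp g γ p :=
  Finset.sum_nonneg fun _ _ => Finset.sum_nonneg fun _ _ =>
    Real.rpow_nonneg (sub_nonneg.2 (Real.cos_le_one _)) _

/-- The map onto `Γ` given by its decomposition into the two cosets of `ker φ`. -/
noncomputable def cosetMap {Γ : Subgroup (OrthGroup n)} {m : ℕ} (γhat : Γ) (g : Fin m → Γ) :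
    Fin m ⊕ Fin m → Γ :=
  Sum.elim g fun i => γhat * g i

lemma cosetMap_bijective {Γ : Subgroup (OrthGroup n)} [Finite Γ] {φ : Γ →* ℤˣ} {m : ℕ}
    (hm : Nat.card Γ = 2 * m) {γhat : Γ} (hγhat : φ γhat = -1) {g : Fin m → Γ}
    (hg : Function.Injective g) (hgφ : ∀ i, φ (g i) = 1) :
    Function.Bijective (cosetMap γhat g) := by
  have hne : ∀ i j, g i ≠ γhat * g j := fun i j h => by
    have := congrArg φ h
    rw [map_mul, hγhat, hgφ, hgφ] at this
    exact absurd this (by decide)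
  have := Fintype.ofFinite Γ
  rw [Fintype.bijective_iff_injective_and_card]
  refine ⟨Function.Injective.sumElim hg (fun i j h => hg (mul_left_cancel h)) hne, ?_⟩
  rw [Fintype.card_sum, Fintype.card_fin, ← Nat.card_eq_fintype_card, hm, two_mul]

/-- Split both indices over the two cosets of `ker φ`. Each of the two equal-sign blocks gives
`μ_p`, since `γ̂` is an isometry; each of the two mixed blocks gives `-μ̂_p` by symmetry of the
inner product. -/
lemma sum_signed_interaction {Γ : Subgroup (OrthGroup n)} [Fintype Γ] [DecidableEq Γ]
    {φ : Γ →* ℤˣ} {m : ℕ} (hm : Nat.card Γ = 2 * m) {γhat : Γ} (hγhat : φ γhat = -1)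
    {g : Fin m → Γ} (hg : Function.Injective g) (hgφ : ∀ i, φ (g i) = 1) (p : Sph n) {s : ℝ}
    (hs : 2 * s = n - 2) :
    (∑ k : Γ, ∑ l : Γ, if k ≠ l then (((φ k : ℤˣ) : ℤ) : ℝ) * (((φ l : ℤˣ) : ℤ) : ℝ) *
      (1 - ⟪(act (k : OrthGroup n) p : Amb n), (act (l : OrthGroup n) p : Amb n)⟫) ^ (-s) else 0) =
    2 * (muSame (fun i => (g i : OrthGroup n)) p -
      muOpp (fun i => (g i : OrthGroup n)) γhat p) := by
  have hbij := cosetMap_bijective hm hγhat hg hgφ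
  have hexp : (2 - (n : ℝ)) / 2 = -s := by linarith
  have h1 : ∀ i, φ (γhat * g i) = -1 := fun i => by rw [map_mul, hγhat, hgφ, mul_one]
  have hne : ∀ i j, g i ≠ γhat * g j := fun i j h =>
    Sum.inl_ne_inr (hbij.1 (show cosetMap γhat g (.inl i) = cosetMap γhat g (.inr j) from h))
  have hsame : muSame (fun i => (g i : OrthGroup n)) p = ∑ i, ∑ j, if i ≠ j then
      (1 - ⟪(act (g i : OrthGroup n) p : Amb n), (act (g j : OrthGroup n) p : Amb n)⟫) ^ (-s)
      else 0 := by
    simp only [muSame, one_sub_cos_geoDist, hexp]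
  have hopp : muOpp (fun i => (g i : OrthGroup n)) γhat p = ∑ i, ∑ j,
      (1 - ⟪(act (g i : OrthGroup n) p : Amb n),
        (act (γhat : OrthGroup n) (act (g j : OrthGroup n) p) : Amb n)⟫) ^ (-s) := by
    simp only [muOpp, one_sub_cos_geoDist, hexp]
  have hopp' : muOpp (fun i => (g i : OrthGroup n)) γhat p = ∑ i, ∑ j,
      (1 - ⟪(act (γhat : OrthGroup n) (act (g i : OrthGroup n) p) : Amb n),
        (act (g j : OrthGroup n) p : Amb n)⟫) ^ (-s) := by
    rw [hopp, Finset.sum_comm]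
    simp only [real_inner_comm]
  let e := Equiv.ofBijective _ hbij
  rw [← Equiv.sum_comp e, Finset.sum_congr rfl fun k _ => (Equiv.sum_comp e _).symm]
  simp only [e, Equiv.ofBijective_apply, Fintype.sum_sum_type, cosetMap, Sum.elim_inl,
    Sum.elim_inr, hgφ, h1, Subgroup.coe_mul, act_mul, Finset.sum_add_distrib, ne_eq, hne,
    fun i j => (hne i j).symm, mul_right_inj, hg.eq_iff, inner_act_act, not_false_eq_true, if_true]
  push_cast
  simp only [one_mul, mul_neg, neg_mul, mul_one, neg_neg, Finset.sum_neg_distrib]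
  simp only [ne_eq] at hsame
  rw [← hsame, ← hopp, ← hopp']
  ring

end YamabeSphere

/-! ### The proposition -/

open YamabeSphere in
theorem proposition3p1 (n : ℕ) (hn : 3 ≤ n)
    (Γ : Subgroup (YamabeSphere.OrthGroup n)) [Finite Γ] (φ : Γ →* ℤˣ)
    (hA0 : YamabeSphere.CondA0 φ) (hA1 : YamabeSphere.CondA1 Γ) (hA2 : YamabeSphere.CondA2 φ)
    (m : ℕ) (hm : Nat.card Γ = 2 * m)
    (γhat : Γ) (hγhat : φ γhat = -1)
    (g : Fin m → Γ) (hg : Function.Injective g) (hgφ : ∀ i, φ (g i) = 1)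
    (hμ : ∃ p : YamabeSphere.Sph n,
      0 < YamabeSphere.muSame (fun i => (g i : YamabeSphere.OrthGroup n)) p -
        YamabeSphere.muOpp (fun i => (g i : YamabeSphere.OrthGroup n)) γhat p) :
    YamabeSphere.cEquiv φ < ((2 * (m : ℝ) * YamabeSphere.cConst n : ℝ) : EReal) := by
  classical
  obtain ⟨p, hp⟩ := hμ
  have := Fintype.ofFinite Γ
  have hfree : ∀ γ ∈ Γ, act γ p = p → γ = 1 := by
    -- A point fixed by `Γ` is excluded by positivity: there every summand of `μ_p` is `0` to a
    -- negative power, which is `0` by convention, while `μ̂_p ≥ 0`.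
    refine (hA1 p).resolve_left fun hfix => ?_
    have h1 := muSame_eq_zero_of_fixed hn (fun i => (g i : OrthGroup n)) p
      fun i => hfix _ (g i).2
    have h2 := muOpp_nonneg (fun i => (g i : OrthGroup n)) γhat p
    linarith
  have hinj : Function.Injective fun k : Γ => act (k : OrthGroup n) p := fun k l h => by
    have h1 : act ((l⁻¹ * k : Γ) : OrthGroup n) p = p := by
      have h2 := congrArg (act ((l⁻¹ : Γ) : OrthGroup n)) h
      simp only [← act_mul, ← Subgroup.coe_mul, inv_mul_cancel] at h2
      exact h2
    have h3 := hfree _ (l⁻¹ * k).2 h1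
    exact (inv_mul_eq_one.1 (Subtype.ext h3)).symm
  have hs : 2 * (((n : ℝ) - 2) / 2) = n - 2 := by ring
  have key := cEquiv_lt_of_interaction_pos hn hs φ (fun k : Γ => act (k : OrthGroup n) p) hinj
    (fun k => (((φ k : ℤˣ) : ℤ) : ℝ)) (fun k => by
      rcases Int.units_eq_one_or (φ k) with h | h <;> simp [h])
    (fun r => isEquivariant_bubbleSum φ p _ r)
    (by rw [sum_signed_interaction hm hγhat hg hgφ p hs]; linarith)
  rw [← Nat.card_eq_fintype_card, hm] at key
  exact_mod_cast key
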